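/- Define, for $s,t\ge 0$, $$K(s,t)=\frac1{\sqrt\pi}\left(\frac{\mathbf 1_{\{s>t\}}}{\sqrt{s-t}}-\frac{\mathbf 1_{\{s>0\}}}{\sqrt s}\right).$$ For every $t\ge 0$ the function $K(\cdot,t)$ is integrable on $(0,\infty)$ and $$\int_0^\infty |K(s,t)|\,ds=\frac{4}{\sqrt\pi}\sqrt t .$$ Let $G$ be a real or complex Hilbert space and let $(R_t)_{t\ge 0}$ be a strongly continuous semigroup of bounded linear operators on $G$ whose infinitesimal generator $L:D(L)\subset G\to G$ is such that $-L$ is self-adjoint and positive, i.e. $\langle -Lv,v\rangle\ge 0$ for all $v\in D(L)$. Then $-L$ has a positive self-adjoint square root, that is, a positive self-adjoint operator $\sqrt{-L}$ with $\sqrt{-L}\,\sqrt{-L}=-L$ (equality of domains included). For any such operator, every $v\in D(\sqrt{-L})$ and every $t\ge 0$, the function $s\mapsto K(s,t)\,R_s\sqrt{-L}\,v$ is Bochner integrable on $(0,\infty)$ and $$R_tv-v=\int_0^\infty K(s,t)\,R_s\sqrt{-L}\,v\,ds .$$ The kernel $K$ is universal: it depends neither on $G$ nor on the semigroup. -/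

import Mathlib

open MeasureTheory Set Filter Topology

noncomputable section

namespace FractionalEstimate

/-- The universal kernel
`K(s,t) = π^{-1/2} (1_{s > t} (s - t)^{-1/2} - 1_{s > 0} s^{-1/2})`. -/
def kernel (s t : ℝ) : ℝ :=
  (1 / √Real.pi) * ((if t < s then 1 / √(s - t) else 0) - (if 0 < s then 1 / √s else 0))

variable {𝕜 G : Type*} [RCLike 𝕜] [NormedAddCommGroup G] [InnerProductSpace 𝕜 G]

/-- `(R t)` for `t ≥ 0` is a strongly continuous semigroup of bounded linear operators on `G`.
The values of `R` at negative times play no role. -/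
structure IsContinuousSemigroup (R : ℝ → G →L[𝕜] G) : Prop where
  map_zero : R 0 = ContinuousLinearMap.id 𝕜 G
  map_add : ∀ s t : ℝ, 0 ≤ s → 0 ≤ t → R (s + t) = (R s).comp (R t)
  continuousOn : ∀ v : G, ContinuousOn (fun t => R t v) (Ici 0)

/-- `w` is the right derivative at time `0` of the orbit `t ↦ R t v`. -/
def HasGeneratorAt (R : ℝ → G →L[𝕜] G) (v w : G) : Prop :=
  Tendsto (fun t : ℝ => ((t⁻¹ : ℝ) : 𝕜) • (R t v - v)) (𝓝[>] 0) (𝓝 w)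

theorem HasGeneratorAt.unique {R : ℝ → G →L[𝕜] G} {v w w' : G}
    (h : HasGeneratorAt R v w) (h' : HasGeneratorAt R v w') : w = w' :=
  tendsto_nhds_unique h h'

theorem HasGeneratorAt.zero (R : ℝ → G →L[𝕜] G) : HasGeneratorAt R 0 0 := by
  simp [HasGeneratorAt]

theorem HasGeneratorAt.add {R : ℝ → G →L[𝕜] G} {v w v' w' : G}
    (h : HasGeneratorAt R v w) (h' : HasGeneratorAt R v' w') :
    HasGeneratorAt R (v + v') (w + w') := by
  refine (Tendsto.add h h').congr fun t => ?_
  rw [_root_.map_add, ← smul_add, add_sub_add_comm]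

theorem HasGeneratorAt.smul {R : ℝ → G →L[𝕜] G} {v w : G} (c : 𝕜)
    (h : HasGeneratorAt R v w) : HasGeneratorAt R (c • v) (c • w) := by
  refine (Tendsto.const_smul h c).congr fun t => ?_
  rw [map_smul, ← smul_sub, smul_comm]

/-- The infinitesimal generator of `R`: its domain consists of all `v` for which
`lim_{t ↓ 0} (R t v - v) / t` exists, and its value at such a `v` is that limit. -/
def generator (R : ℝ → G →L[𝕜] G) : G →ₗ.[𝕜] G where
  domain :=
    { carrier := {v | ∃ w, HasGeneratorAt R v w}
      zero_mem' := ⟨0, HasGeneratorAt.zero R⟩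
      add_mem' := fun ⟨_, h⟩ ⟨_, h'⟩ => ⟨_, h.add h'⟩
      smul_mem' := fun c _ ⟨_, h⟩ => ⟨_, h.smul c⟩ }
  toFun :=
    { toFun := fun v => v.2.choose
      map_add' := fun v v' =>
        (v + v').2.choose_spec.unique (v.2.choose_spec.add v'.2.choose_spec)
      map_smul' := fun c v => (c • v).2.choose_spec.unique (v.2.choose_spec.smul c) }

theorem mem_graph_generator_iff (R : ℝ → G →L[𝕜] G) (v w : G) :
    (v, w) ∈ (generator R).graph ↔ HasGeneratorAt R v w := by
  rw [LinearPMap.mem_graph_iff]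
  constructor
  · rintro ⟨y, rfl, rfl⟩
    exact y.2.choose_spec
  · intro h
    have hv : ∃ w, HasGeneratorAt R v w := ⟨w, h⟩
    exact ⟨⟨v, hv⟩, rfl, hv.choose_spec.unique h⟩

/-- `A` is a positive self-adjoint, possibly unbounded, operator. Mathlib's `IsSelfAdjoint`
for partially defined operators means `A† = A`, domains included, and forces a dense domain. -/
structure IsPositiveSelfAdjoint [CompleteSpace G] (A : G →ₗ.[𝕜] G) : Prop where
  isSelfAdjoint : IsSelfAdjoint A
  nonneg : ∀ v : A.domain, 0 ≤ RCLike.re (inner 𝕜 (A v) (v : G))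

/-- `S = √A`: the operator `S` is positive self-adjoint and `S ∘ S = A`, where `S ∘ S` has its
natural domain `{v ∈ D(S) | S v ∈ D(S)}`. -/
structure IsPositiveSqrt [CompleteSpace G] (A S : G →ₗ.[𝕜] G) : Prop where
  isPositiveSelfAdjoint : IsPositiveSelfAdjoint S
  sq_eq : ∀ v w : G, (v, w) ∈ A.graph ↔ ∃ u : G, (v, u) ∈ S.graph ∧ (u, w) ∈ S.graph

end FractionalEstimate

end

/-!
Write `A = -L` and `R s = e^{-sA}`. For a number `x > 0` the formula is the identity
`e^{-tx} - 1 = ∫ K(s,t) e^{-sx} √x ds`, which expresses that `π^{-1/2} s^{-1/2}` has Laplace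
transform `x^{-1/2}`: the two terms of the kernel are a copy of this weight shifted by `t` and an
unshifted one. The proof carries this over to operators without the spectral theorem for unbounded
operators, using bounded operators only; this treats real and complex scalars alike.

*Bounded operators.* A bounded positive operator has a positive square root, the limit of the
iteration `Y ↦ (W + Y²) / 2`, which commutes with the commutant (`exists_isPositive_sqrt`).
For commuting positive `P`, `Q` one gets `‖(P - Q) x‖² ≤ ‖(P² - Q²) x‖ ‖x‖`
(`norm_sub_apply_sq_le_of_isPositive`), which gives uniqueness of the square root and is the
estimate behind the limit below.

*Square roots of `A`.* Self-adjointness and positivity make `B = (1 + A)⁻¹` an everywhere defined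
bounded operator. With `C = √B` and `D = √(1 - B)`, the operator with graph `{(C x, D x)}` is a
square root of `A` (`IsPositiveSelfAdjoint.exists_isPositiveSqrt`). For an arbitrary square root `S`
the operator `Q = S B` is the bounded positive square root of `B - B²`, and `Q v = B (S v)` on the
domain of `S` (`IsPositiveSqrt.exists_mul_resolvent`).

*The formula.* The `R s` are symmetric contractions, so that `K(·,t)` can be integrated against
them. For `r > 0` the operator `J = π^{-1/2} ∫ s^{-1/2} e^{-rs} R s ds` satisfies `J² = (r + A)⁻¹`
(`average_rsqrtWeight_mul_self`, by polar coordinates after `s = a²`), and damping the kernel by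
`e^{-rs}` turns the integral into `(e^{-rt} R t - 1) J` (`integral_exp_mul_kernel`). As `r → 0`,
`(1 - R t) J Q` tends to `(1 - R t) B`, because the squares of the positive operators `J Q` and `B`
differ by `-r (r + A)⁻¹ B²` (`norm_rsqrt_mul_sub_le`). This is the formula for vectors `B z`; since
`B` is injective and commutes with all operators involved, it follows on the whole domain of `S`.
-/

namespace FractionalEstimate

/-! ### Square roots of bounded positive operators -/

section BoundedOperators

variable {𝕜 G : Type*} [RCLike 𝕜] [NormedAddCommGroup G] [InnerProductSpace 𝕜 G]

theorem norm_sq_le_re_inner_of_isPositive {P : G →L[𝕜] G} (hP : P.IsPositive) (h1 : ‖P‖ ≤ 1)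
    (x : G) : ‖P x‖ ^ 2 ≤ RCLike.re (inner 𝕜 (P x) x) := by
  -- positivity of the quadratic form at `x - P x`
  have h := hP.re_inner_nonneg_left (x - P x)
  have h2 : RCLike.re (inner 𝕜 (P (P x)) (P x)) ≤ ‖P x‖ ^ 2 := by
    calc RCLike.re (inner 𝕜 (P (P x)) (P x)) ≤ ‖P (P x)‖ * ‖P x‖ := re_inner_le_norm _ _
      _ ≤ (1 * ‖P x‖) * ‖P x‖ := by gcongr; exact P.le_of_opNorm_le h1 _
      _ = ‖P x‖ ^ 2 := by ring
  have h3 : inner 𝕜 (P (P x)) x = inner 𝕜 (P x) (P x) := hP.inner_left_eq_inner_right _ _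
  rw [map_sub, inner_sub_left, inner_sub_right, inner_sub_right, h3] at h
  simp only [map_sub, inner_self_eq_norm_sq] at h
  linarith

theorem norm_one_sub_le_one_of_isPositive {P : G →L[𝕜] G} (hP : P.IsPositive) (h1 : ‖P‖ ≤ 1) :
    ‖1 - P‖ ≤ 1 := by
  refine ContinuousLinearMap.opNorm_le_bound _ zero_le_one fun x => ?_
  rw [one_mul]
  refine le_of_sq_le_sq ?_ (norm_nonneg _)
  have h2 := norm_sq_le_re_inner_of_isPositive hP h1 x
  have h3 : ‖(1 - P) x‖ ^ 2 = ‖x‖ ^ 2 - 2 * RCLike.re (inner 𝕜 x (P x)) + ‖P x‖ ^ 2 :=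
    norm_sub_sq (𝕜 := 𝕜) _ _
  rw [inner_re_symm] at h3
  nlinarith [sq_nonneg ‖P x‖]

/-- The iteration `Y ↦ (W + Y²) / 2` started at `0`. Its limit `V` solves `(1 - V)² = 1 - W`. -/
noncomputable def sqrtIter (W : G →L[𝕜] G) : ℕ → (G →L[𝕜] G)
  | 0 => 0
  | n + 1 => (2⁻¹ : 𝕜) • (W + sqrtIter W n * sqrtIter W n)

/-- The scalar analogue of `sqrtIter` at `W = 1`, which dominates it. -/
noncomputable def sqrtIterBound : ℕ → ℝ
  | 0 => 0
  | n + 1 => 2⁻¹ * (1 + sqrtIterBound n * sqrtIterBound n)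

theorem sqrtIterBound_mem (n : ℕ) : 0 ≤ sqrtIterBound n ∧ sqrtIterBound n ≤ 1 := by
  induction n with
  | zero => simp [sqrtIterBound]
  | succ n ih => constructor <;> rw [sqrtIterBound] <;> nlinarith [ih.1, ih.2]

theorem sqrtIter_commute {W Z : G →L[𝕜] G} (h : Commute Z W) (n : ℕ) :
    Commute Z (sqrtIter W n) := by
  induction n with
  | zero => exact Commute.zero_right _
  | succ n ih => exact (h.add_right (ih.mul_right ih)).smul_right _

theorem norm_sqrtIter_le {W : G →L[𝕜] G} (h : ‖W‖ ≤ 1) (n : ℕ) :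
    ‖sqrtIter W n‖ ≤ sqrtIterBound n := by
  induction n with
  | zero => simp [sqrtIter, sqrtIterBound]
  | succ n ih =>
    rw [sqrtIter, sqrtIterBound, norm_smul]
    have : ‖(2⁻¹ : 𝕜)‖ = 2⁻¹ := by simp
    rw [this]
    gcongr
    refine (norm_add_le _ _).trans (add_le_add h ((norm_mul_le _ _).trans ?_))
    gcongr
    exact (sqrtIterBound_mem n).1

theorem norm_sqrtIter_succ_sub_le {W : G →L[𝕜] G} (h : ‖W‖ ≤ 1) (n : ℕ) :
    ‖sqrtIter W (n + 1) - sqrtIter W n‖ ≤ sqrtIterBound (n + 1) - sqrtIterBound n := by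
  have h2 : ‖(2⁻¹ : 𝕜)‖ = 2⁻¹ := by simp
  induction n with
  | zero => simpa [sqrtIter, sqrtIterBound, norm_smul] using h
  | succ n ih =>
    set a := sqrtIter W (n + 1) with ha
    set b := sqrtIter W n with hb
    have hab : Commute a b :=
      (sqrtIter_commute (sqrtIter_commute (Commute.refl W) (n + 1)).symm n).symm.symm
    have ea : a = (2⁻¹ : 𝕜) • (W + b * b) := by rw [ha, sqrtIter]
    have e : sqrtIter W (n + 1 + 1) - a = (2⁻¹ : 𝕜) • ((a + b) * (a - b)) := by
      rw [← hab.mul_self_sub_mul_self_eq, sqrtIter, ← ha]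
      nth_rewrite 3 [ea]
      rw [← smul_sub, add_sub_add_left_eq_sub]
    rw [e, norm_smul, h2]
    have e2 : sqrtIterBound (n + 1 + 1) - sqrtIterBound (n + 1) =
        2⁻¹ * ((sqrtIterBound (n + 1) + sqrtIterBound n) *
          (sqrtIterBound (n + 1) - sqrtIterBound n)) := by
      have hy : sqrtIterBound (n + 1) = 2⁻¹ * (1 + sqrtIterBound n * sqrtIterBound n) := rfl
      rw [sqrtIterBound]
      linear_combination -hy
    rw [e2]
    gcongr
    refine (norm_mul_le _ _).trans ?_
    gcongr
    · exact add_nonneg (sqrtIterBound_mem _).1 (sqrtIterBound_mem _).1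
    · exact (norm_add_le _ _).trans
        (add_le_add (norm_sqrtIter_le h _) (norm_sqrtIter_le h _))

variable [CompleteSpace G]

theorem sqrtIter_isSelfAdjoint {W : G →L[𝕜] G} (h : IsSelfAdjoint W) (n : ℕ) :
    IsSelfAdjoint (sqrtIter W n) := by
  induction n with
  | zero => exact IsSelfAdjoint.zero _
  | succ n ih =>
    refine IsSelfAdjoint.smul ?_ (h.add ?_)
    · simp [IsSelfAdjoint]
    · exact (IsSelfAdjoint.commute_iff ih ih).1 rfl

theorem exists_one_sub_sq_eq_one_sub {W : G →L[𝕜] G} (h : ‖W‖ ≤ 1) (hW : IsSelfAdjoint W) :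
    ∃ V : G →L[𝕜] G, ‖V‖ ≤ 1 ∧ IsSelfAdjoint V ∧ (1 - V) * (1 - V) = 1 - W ∧
      ∀ Z, Commute Z W → Commute Z V := by
  have hmono : Monotone sqrtIterBound := monotone_nat_of_le_succ fun n => by
    rw [sqrtIterBound]; nlinarith [sq_nonneg (1 - sqrtIterBound n)]
  have hsum : Summable fun n => sqrtIterBound (n + 1) - sqrtIterBound n := by
    refine summable_of_sum_range_le (c := 1) (fun n => sub_nonneg.2 (hmono n.le_succ)) fun n => ?_
    rw [Finset.sum_range_sub]
    simpa [sqrtIterBound] using (sqrtIterBound_mem n).2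
  have hc : CauchySeq (sqrtIter W) := by
    refine cauchySeq_of_dist_le_of_summable _ (fun n => ?_) hsum
    rw [dist_comm, dist_eq_norm]
    exact norm_sqrtIter_succ_sub_le h n
  obtain ⟨V, hV⟩ := cauchySeq_tendsto_of_complete hc
  refine ⟨V, ?_, ?_, ?_, fun Z hZ => ?_⟩
  · exact le_of_tendsto hV.norm (Eventually.of_forall fun n =>
      (norm_sqrtIter_le h n).trans (sqrtIterBound_mem n).2)
  · exact tendsto_nhds_unique (((continuous_star.tendsto V).comp hV).congr
      fun n => (sqrtIter_isSelfAdjoint hW n)) hV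
  · have h1 := (tendsto_add_atTop_iff_nat 1).2 hV
    have h2 : Tendsto (fun n => sqrtIter W (n + 1)) atTop
        (𝓝 ((2⁻¹ : 𝕜) • (W + V * V))) := ((hV.mul hV).const_add W).const_smul _
    have h3 := tendsto_nhds_unique h1 h2
    have h4 : (2 : 𝕜) • V = W + V * V := by
      conv_lhs => rw [h3]
      rw [smul_smul, mul_inv_cancel₀ two_ne_zero, one_smul]
    rw [two_smul] at h4
    have : (1 - V) * (1 - V) = 1 - (V + V) + V * V := by noncomm_ring
    rw [this, h4]; abel
  · exact tendsto_nhds_unique ((hV.const_mul Z).congr fun n => sqrtIter_commute hZ n)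
      (hV.mul_const Z)

/-- A bounded positive operator has a bounded positive square root which commutes with everything
that the operator commutes with. The argument covers real and complex scalars alike. -/
theorem exists_isPositive_sqrt {X : G →L[𝕜] G} (hX : X.IsPositive) :
    ∃ Y : G →L[𝕜] G, Y.IsPositive ∧ Y * Y = X ∧ ∀ Z, Commute Z X → Commute Z Y := by
  set c : ℝ := ‖X‖ + 1 with hc
  have hc0 : 0 < c := by positivity
  have hc1 : (c : 𝕜) ≠ 0 := by exact_mod_cast hc0.ne'
  set P : G →L[𝕜] G := ((c⁻¹ : ℝ) : 𝕜) • X with hP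
  have hPpos : P.IsPositive := hX.smul_of_nonneg (by
    rw [RCLike.ofReal_nonneg]; positivity)
  have hPn : ‖P‖ ≤ 1 := by
    rw [hP, norm_smul, RCLike.norm_ofReal, abs_of_pos (inv_pos.2 hc0), inv_mul_le_iff₀ hc0]
    linarith
  obtain ⟨V, hV1, hV2, hV3, hV4⟩ := exists_one_sub_sq_eq_one_sub
    (norm_one_sub_le_one_of_isPositive hPpos hPn) ((IsSelfAdjoint.one _).sub hPpos.isSelfAdjoint)
  have hVpos : (1 - V).IsPositive := by
    rw [ContinuousLinearMap.isPositive_def']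
    refine ⟨(IsSelfAdjoint.one _).sub hV2, fun x => ?_⟩
    rw [ContinuousLinearMap.reApplyInnerSelf_apply]
    have : RCLike.re (inner 𝕜 (V x) x) ≤ ‖x‖ ^ 2 := by
      refine (re_inner_le_norm _ _).trans ?_
      have := V.le_of_opNorm_le hV1 x
      nlinarith [norm_nonneg x]
    simp only [_root_.sub_apply, one_apply_eq_self, inner_sub_left,
      map_sub, inner_self_eq_norm_sq]
    linarith
  refine ⟨((√c : ℝ) : 𝕜) • (1 - V), hVpos.smul_of_nonneg (by
    rw [RCLike.ofReal_nonneg]; positivity), ?_, fun Z hZ => ?_⟩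
  · rw [smul_mul_smul_comm, hV3, sub_sub_cancel, ← RCLike.ofReal_mul, Real.mul_self_sqrt hc0.le,
      hP, smul_smul, ← RCLike.ofReal_mul, mul_inv_cancel₀ hc0.ne']
    simp
  · refine ((Commute.one_right Z).sub_right (hV4 Z ?_)).smul_right _
    exact (Commute.one_right Z).sub_right (hZ.smul_right _)

theorem isPositive_mul_of_commute {P Q : G →L[𝕜] G} (hP : P.IsPositive) (hQ : Q.IsPositive)
    (h : Commute P Q) : (P * Q).IsPositive := by
  obtain ⟨E, hE, rfl, hEc⟩ := exists_isPositive_sqrt hP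
  have hEQ := hEc Q h.symm
  have e : E * E * Q = E * Q * E := by rw [mul_assoc E E Q, mul_assoc E Q E, hEQ.eq]
  have := hQ.conj_adjoint E
  rw [hE.isSelfAdjoint.adjoint_eq] at this
  rw [e]
  exact this

/-- For commuting positive `P` and `Q`, `(P - Q)⁴ ≤ (P - Q)² (P + Q)² = (P² - Q²)²`. -/
theorem norm_sub_sub_le_of_isPositive {P Q : G →L[𝕜] G} (hP : P.IsPositive) (hQ : Q.IsPositive)
    (h : Commute P Q) (x : G) :
    ‖(P - Q) ((P - Q) x)‖ ≤ ‖(P * P - Q * Q) x‖ := by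
  set y := (P - Q) x with hy
  have e1 : (P * P - Q * Q) x = (P + Q) y := by rw [h.mul_self_sub_mul_self_eq]; rfl
  rw [e1]
  refine le_of_sq_le_sq ?_ (norm_nonneg _)
  have e2 := norm_add_sq (𝕜 := 𝕜) (P y) (Q y)
  have e3 := norm_sub_sq (𝕜 := 𝕜) (P y) (Q y)
  have e4 : 0 ≤ RCLike.re (inner 𝕜 (P y) (Q y)) := by
    have := (isPositive_mul_of_commute hP hQ h).re_inner_nonneg_right y
    rwa [mul_apply_eq_comp, ← hP.inner_left_eq_inner_right] at this
  rw [_root_.sub_apply, _root_.add_apply, e2, e3]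
  linarith

theorem norm_sub_apply_sq_le_of_isPositive {P Q : G →L[𝕜] G} (hP : P.IsPositive)
    (hQ : Q.IsPositive) (h : Commute P Q) (x : G) :
    ‖(P - Q) x‖ ^ 2 ≤ ‖(P * P - Q * Q) x‖ * ‖x‖ := by
  have hs : (P - Q).IsSymmetric := (hP.isSymmetric).sub hQ.isSymmetric
  calc ‖(P - Q) x‖ ^ 2 = RCLike.re (inner 𝕜 ((P - Q) x) ((P - Q) x)) :=
        (inner_self_eq_norm_sq _).symm
    _ = RCLike.re (inner 𝕜 ((P - Q) ((P - Q) x)) x) := congrArg _ (hs ((P - Q) x) x).symm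
    _ ≤ ‖(P - Q) ((P - Q) x)‖ * ‖x‖ := re_inner_le_norm _ _
    _ ≤ _ := by gcongr; exact norm_sub_sub_le_of_isPositive hP hQ h x

/-- The bounded positive square root of a bounded operator commutes with the commutant of that
operator, by uniqueness of the square root. -/
theorem commute_of_commute_mul_self {Q Z : G →L[𝕜] G} (hQ : Q.IsPositive)
    (h : Commute Z (Q * Q)) : Commute Z Q := by
  have hX : (Q * Q).IsPositive := isPositive_mul_of_commute hQ hQ rfl
  obtain ⟨Y, hY, hYY, hYc⟩ := exists_isPositive_sqrt hX
  have hc : Commute Q Y := hYc Q ((Commute.refl Q).mul_right rfl)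
  have : Q = Y := by
    ext x
    have := norm_sub_apply_sq_le_of_isPositive hQ hY hc x
    rw [hYY, sub_self, _root_.zero_apply, norm_zero, zero_mul] at this
    have h0 : ‖(Q - Y) x‖ = 0 := by nlinarith [norm_nonneg ((Q - Y) x)]
    exact sub_eq_zero.1 (norm_eq_zero.1 h0)
  rw [this]
  exact hYc Z h

end BoundedOperators

/-! ### Resolvents and square roots of positive self-adjoint operators -/

section UnboundedOperators

variable {𝕜 G : Type*} [RCLike 𝕜] [NormedAddCommGroup G] [InnerProductSpace 𝕜 G] [CompleteSpace G]

theorem mem_graph_iff_of_isSelfAdjoint {A : G →ₗ.[𝕜] G} (hA : IsSelfAdjoint A) {x y : G} :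
    (x, y) ∈ A.graph ↔ ∀ a b, (a, b) ∈ A.graph → inner 𝕜 b x = inner 𝕜 a y := by
  have h := Submodule.mem_adjoint_iff A.graph (x, y)
  rw [← LinearPMap.adjoint_graph_eq_graph_adjoint hA.dense_domain,
    LinearPMap.isSelfAdjoint_def.1 hA] at h
  simpa only [sub_eq_zero] using h

theorem isSelfAdjoint_of_mem_graph_iff {A : G →ₗ.[𝕜] G} (hd : Dense (A.domain : Set G))
    (h : ∀ x y, (x, y) ∈ A.graph ↔ ∀ a b, (a, b) ∈ A.graph → inner 𝕜 b x = inner 𝕜 a y) :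
    IsSelfAdjoint A := by
  rw [LinearPMap.isSelfAdjoint_def]
  refine LinearPMap.eq_of_eq_graph ?_
  rw [LinearPMap.adjoint_graph_eq_graph_adjoint hd]
  ext ⟨x, y⟩
  rw [h, Submodule.mem_adjoint_iff]
  simp only [sub_eq_zero]

namespace IsPositiveSelfAdjoint

variable {A : G →ₗ.[𝕜] G} (hA : IsPositiveSelfAdjoint A)
include hA

theorem re_inner_nonneg {u w : G} (h : (u, w) ∈ A.graph) : 0 ≤ RCLike.re (inner 𝕜 w u) := by
  obtain ⟨y, rfl, rfl⟩ := (LinearPMap.mem_graph_iff A).1 h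
  exact hA.nonneg y

theorem inner_eq {u w u' w' : G} (h : (u, w) ∈ A.graph) (h' : (u', w') ∈ A.graph) :
    inner 𝕜 w u' = inner 𝕜 u w' :=
  (mem_graph_iff_of_isSelfAdjoint hA.isSelfAdjoint).1 h' _ _ h

theorem norm_sq_add_le {u w : G} (h : (u, w) ∈ A.graph) {r : ℝ} (hr : 0 ≤ r) :
    ‖w‖ ^ 2 + r ^ 2 * ‖u‖ ^ 2 ≤ ‖w + (r : 𝕜) • u‖ ^ 2 := by
  have h1 := norm_add_sq (𝕜 := 𝕜) w ((r : 𝕜) • u)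
  rw [inner_smul_right, RCLike.re_ofReal_mul, norm_smul, RCLike.norm_ofReal, abs_of_nonneg hr,
    mul_pow] at h1
  have := mul_nonneg hr (hA.re_inner_nonneg h)
  linarith

theorem norm_le_norm_add {u w : G} (h : (u, w) ∈ A.graph) {r : ℝ} (hr : 0 ≤ r) :
    ‖w‖ ≤ ‖w + (r : 𝕜) • u‖ := by
  refine le_of_sq_le_sq ?_ (norm_nonneg _)
  have := hA.norm_sq_add_le h hr
  nlinarith [mul_nonneg (sq_nonneg r) (sq_nonneg ‖u‖)]

theorem mul_norm_le_norm_add {u w : G} (h : (u, w) ∈ A.graph) {r : ℝ} (hr : 0 ≤ r) :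
    r * ‖u‖ ≤ ‖w + (r : 𝕜) • u‖ := by
  refine le_of_sq_le_sq ?_ (norm_nonneg _)
  have := hA.norm_sq_add_le h hr
  nlinarith [sq_nonneg ‖w‖]

/-- `A + r` is onto for `r > 0`: its range is closed because `A` is closed and `A + r` is bounded
below, and dense because a vector orthogonal to it is an eigenvector of `A` for `-r`. -/
theorem exists_add_eq {r : ℝ} (hr : 0 < r) (z : G) :
    ∃ u w, (u, w) ∈ A.graph ∧ w + (r : 𝕜) • u = z := by
  have hr' : (r : 𝕜) ≠ 0 := by exact_mod_cast hr.ne'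
  let f : A.graph →L[𝕜] G := ((ContinuousLinearMap.snd 𝕜 G G) +
    (r : 𝕜) • (ContinuousLinearMap.fst 𝕜 G G)).comp A.graph.subtypeL
  have hcl : IsClosed (A.graph : Set (G × G)) := hA.isSelfAdjoint.isClosed
  have : CompleteSpace A.graph := hcl.completeSpace_coe
  have hf : ∀ p : A.graph, f p = p.1.2 + (r : 𝕜) • p.1.1 := fun p => rfl
  have hanti : AntilipschitzWith (Real.toNNReal (1 + r⁻¹)) f := by
    refine AddMonoidHomClass.antilipschitz_of_bound f fun p => ?_
    have h1 := hA.norm_le_norm_add p.2 hr.le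
    have h2 := hA.mul_norm_le_norm_add p.2 hr.le
    rw [Real.coe_toNNReal _ (by positivity), hf]
    set q := ‖p.1.2 + (r : 𝕜) • p.1.1‖
    have hq : 0 ≤ q := norm_nonneg _
    have h3 : 0 ≤ r⁻¹ * q := by positivity
    refine (norm_prod_le_iff (x := p.1)).2 ⟨?_, ?_⟩
    · have : ‖p.1.1‖ ≤ r⁻¹ * q := by rwa [le_inv_mul_iff₀ hr]
      linarith
    · linarith
  have hrc : IsClosed (LinearMap.range (f : A.graph →ₗ[𝕜] G) : Set G) := by
    rw [LinearMap.coe_range]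
    exact hanti.isClosed_range f.uniformContinuous
  have htop : LinearMap.range (f : A.graph →ₗ[𝕜] G) = ⊤ := by
    have : CompleteSpace (LinearMap.range (f : A.graph →ₗ[𝕜] G)) := hrc.completeSpace_coe
    rw [← Submodule.orthogonal_eq_bot_iff, Submodule.eq_bot_iff]
    intro u hu
    have hmem : (u, -((r : 𝕜) • u)) ∈ A.graph := by
      rw [mem_graph_iff_of_isSelfAdjoint hA.isSelfAdjoint]
      intro a b hab
      have := (Submodule.mem_orthogonal _ _).1 hu _ ⟨⟨(a, b), hab⟩, rfl⟩
      rw [ContinuousLinearMap.coe_coe, hf] at this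
      simp only [inner_add_left, inner_smul_left, RCLike.conj_ofReal] at this
      rw [inner_neg_right, inner_smul_right]
      exact eq_neg_of_add_eq_zero_left this
    have := hA.mul_norm_le_norm_add hmem hr.le
    rw [neg_add_cancel, norm_zero] at this
    have h0 : ‖u‖ ≤ 0 := by nlinarith [norm_nonneg u]
    exact norm_le_zero_iff.1 h0
  obtain ⟨p, hp⟩ := LinearMap.range_eq_top.1 htop z
  exact ⟨p.1.1, p.1.2, p.2, hp⟩

theorem eq_of_add_eq {r : ℝ} (hr : 0 < r) {u w u' w' : G} (h : (u, w) ∈ A.graph)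
    (h' : (u', w') ∈ A.graph) (e : w + (r : 𝕜) • u = w' + (r : 𝕜) • u') : u = u' := by
  have h1 : (u - u', w - w') ∈ A.graph := A.graph.sub_mem h h'
  have := hA.mul_norm_le_norm_add h1 hr.le
  have e2 : w - w' + (r : 𝕜) • (u - u') = 0 := by
    rw [smul_sub, sub_add_sub_comm, e, sub_self]
  rw [e2, norm_zero] at this
  have h0 : ‖u - u'‖ ≤ 0 := by nlinarith [norm_nonneg (u - u')]
  exact sub_eq_zero.1 (norm_le_zero_iff.1 h0)

/-- The resolvent `B = (A + r)⁻¹`, described by its graph. -/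
theorem exists_resolvent {r : ℝ} (hr : 0 < r) :
    ∃ B : G →L[𝕜] G, B.IsPositive ∧ ∀ u w, (u, w) ∈ A.graph ↔ B (w + (r : 𝕜) • u) = u := by
  choose U W hUW hz using fun z => hA.exists_add_eq hr z
  have hU : ∀ u w, (u, w) ∈ A.graph → U (w + (r : 𝕜) • u) = u := fun u w h =>
    hA.eq_of_add_eq hr (hUW _) h (hz _)
  let T : G →ₗ[𝕜] G :=
    { toFun := U
      map_add' := fun x y => by
        have := hU _ _ (A.graph.add_mem (hUW x) (hUW y))
        rw [← this]
        congr 1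
        change _ = W x + W y + (r : 𝕜) • (U x + U y)
        rw [smul_add, add_add_add_comm, hz, hz]
      map_smul' := fun c x => by
        have := hU _ _ (A.graph.smul_mem c (hUW x))
        rw [RingHom.id_apply, ← this]
        congr 1
        change _ = c • W x + (r : 𝕜) • (c • U x)
        rw [smul_comm, ← smul_add, hz] }
  have hT : T.IsSymmetric := fun x y => by
    change inner 𝕜 (U x) y = inner 𝕜 x (U y)
    conv_lhs => rw [← hz y]
    conv_rhs => rw [← hz x]
    simp only [inner_add_left, inner_add_right, inner_smul_left, inner_smul_right,
      RCLike.conj_ofReal, hA.inner_eq (hUW x) (hUW y)]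
  refine ⟨⟨T, hT.continuous⟩, ⟨hT, fun x => ?_⟩, fun u w => ⟨hU u w, fun h => ?_⟩⟩
  · change 0 ≤ RCLike.re (inner 𝕜 (U x) x)
    have e : inner 𝕜 (U x) x = inner 𝕜 (U x) (W x) + r * inner 𝕜 (U x) (U x) := by
      rw [← inner_smul_right, ← inner_add_right, hz]
    rw [e, map_add, RCLike.re_ofReal_mul, inner_re_symm, inner_self_eq_norm_sq]
    have := hA.re_inner_nonneg (hUW x)
    positivity
  · change U (w + (r : 𝕜) • u) = u at h
    have h1 := hUW (w + (r : 𝕜) • u)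
    have h2 := hz (w + (r : 𝕜) • u)
    rw [h, add_left_inj] at h2
    rwa [h, h2] at h1

/-- Every positive self-adjoint operator has a positive self-adjoint square root. With
`B = (1 + A)⁻¹`, `C = √B` and `D = √(1 - B)` it is `D C⁻¹`, whose graph is the image of the
isometry `x ↦ (C x, D x)`. -/
theorem exists_isPositiveSqrt : ∃ S : G →ₗ.[𝕜] G, IsPositiveSqrt A S := by
  obtain ⟨B, hB, hBA⟩ := hA.exists_resolvent one_pos
  simp only [RCLike.ofReal_one, one_smul] at hBA
  have hBg : ∀ z, (B z, z - B z) ∈ A.graph := fun z => by rw [hBA, sub_add_cancel]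
  have hB1 : (1 - B).IsPositive := by
    refine ⟨LinearMap.IsSymmetric.sub (LinearMap.IsSymmetric.id) hB.isSymmetric, fun x => ?_⟩
    change 0 ≤ RCLike.re (inner 𝕜 (x - B x) x)
    have h := hA.re_inner_nonneg (hBg x)
    have : inner 𝕜 (x - B x) x = inner 𝕜 (x - B x) (B x) + inner 𝕜 (x - B x) (x - B x) := by
      rw [← inner_add_right, add_sub_cancel]
    rw [this, map_add, inner_self_eq_norm_sq]
    positivity
  obtain ⟨C, hC, hCC, hCc⟩ := exists_isPositive_sqrt hB
  obtain ⟨D, hD, hDD, hDc⟩ := exists_isPositive_sqrt hB1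
  have hDC : Commute C D := by
    refine hDc C ((Commute.one_right C).sub_right ?_)
    rw [← hCC]
    exact (Commute.refl C).mul_right rfl
  have hCD' : ∀ x, C (D x) = D (C x) := fun x => congrArg (fun T : G →L[𝕜] G => T x) hDC.eq
  have hCC' : ∀ x, C (C x) = B x := fun x => congrArg (fun T : G →L[𝕜] G => T x) hCC
  have hDD' : ∀ x, D (D x) = x - B x := fun x => congrArg (fun T : G →L[𝕜] G => T x) hDD
  have hBinj : ∀ x, B x = 0 → x = 0 := fun x h => by
    have h1 := hBg x
    rw [h, sub_zero] at h1
    exact LinearPMap.graph_fst_eq_zero_snd A h1 rfl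
  have hCinj : ∀ x, C x = 0 → x = 0 := fun x h => hBinj x (by rw [← hCC', h, map_zero])
  let g : Submodule 𝕜 (G × G) := LinearMap.range ((C : G →ₗ[𝕜] G).prod (D : G →ₗ[𝕜] G))
  have hg : ∀ x y, (x, y) ∈ g ↔ ∃ z, C z = x ∧ D z = y := fun x y => by
    change (∃ z, (C z, D z) = (x, y)) ↔ _
    simp only [Prod.mk.injEq]
  have hgS : g.toLinearPMap.graph = g := by
    refine Submodule.toLinearPMap_graph_eq g ?_
    rintro ⟨x, y⟩ hxy (h0 : x = 0)
    obtain ⟨z, rfl, rfl⟩ := (hg x y).1 hxy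
    change D z = 0
    rw [hCinj z h0, map_zero]
  -- the isometry `x ↦ (C x, D x)` is onto the set of pairs satisfying `C w = D u`
  have hkey : ∀ u w, C w = D u → C (C u + D w) = u ∧ D (C u + D w) = w := fun u w h => by
    constructor
    · rw [map_add, hCC', hCD', h, hDD', add_sub_cancel]
    · rw [map_add, ← hCD', ← h, hCC', hDD', add_sub_cancel]
  have hdense : Dense (g.toLinearPMap.domain : Set G) := by
    rw [Submodule.dense_iff_topologicalClosure_eq_top, Submodule.topologicalClosure_eq_top_iff,
      Submodule.eq_bot_iff]
    intro x hx
    refine hCinj x ((inner_self_eq_zero (𝕜 := 𝕜)).1 ?_)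
    rw [hC.inner_left_eq_inner_right, ← inner_conj_symm]
    have hm : C (C x) ∈ g.toLinearPMap.domain :=
      LinearPMap.mem_domain_of_mem_graph (y := D (C x)) (by rw [hgS, hg]; exact ⟨_, rfl, rfl⟩)
    rw [(Submodule.mem_orthogonal _ _).1 hx _ hm, map_zero]
  refine ⟨g.toLinearPMap, ⟨⟨isSelfAdjoint_of_mem_graph_iff hdense fun u w => ?_, ?_⟩, ?_⟩⟩
  · rw [hgS]
    constructor
    · rw [hg]
      rintro ⟨x, rfl, rfl⟩ a b hab
      obtain ⟨y, rfl, rfl⟩ := (hg a b).1 hab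
      rw [hD.inner_left_eq_inner_right, hC.inner_left_eq_inner_right, hCD']
    · intro h
      have e : C w = D u := by
        refine ext_inner_left 𝕜 fun x => ?_
        rw [← hC.inner_left_eq_inner_right, ← hD.inner_left_eq_inner_right]
        exact (h _ _ ((hg _ _).2 ⟨x, rfl, rfl⟩)).symm
      exact (hg _ _).2 ⟨C u + D w, hkey u w e⟩
  · intro v
    have hv := g.toLinearPMap.mem_graph v
    rw [hgS, hg] at hv
    obtain ⟨x, h1, h2⟩ := hv
    rw [← h1, ← h2, ← hC.inner_left_eq_inner_right]
    exact (isPositive_mul_of_commute hC hD hDC).re_inner_nonneg_left x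
  · intro v w
    simp only [hgS, hg]
    constructor
    · intro h
      refine ⟨C (D (v + w)), ⟨C (v + w), ?_, (hCD' _).symm⟩, ⟨D (v + w), rfl, ?_⟩⟩
      · rw [hCC', add_comm, (hBA v w).1 h]
      · rw [hDD', add_comm v w, (hBA v w).1 h, add_sub_cancel_right]
    · rintro ⟨u, ⟨x, rfl, hx⟩, ⟨y, hy, rfl⟩⟩
      obtain ⟨h1, h2⟩ := hkey x y (hy.trans hx.symm)
      have := hBg (C x + D y)
      rwa [← hDD', ← hCC', h1, h2] at this

end IsPositiveSelfAdjoint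

namespace IsPositiveSqrt

variable {A S : G →ₗ.[𝕜] G} (hS : IsPositiveSqrt A S)
include hS

/-- For `S = √A` and `B = (1 + A)⁻¹` the operator `Q = S B` is bounded and positive, its square is
`B - B²`, and `S B = B S` on the domain of `S`. -/
theorem exists_mul_resolvent {B : G →L[𝕜] G}
    (hB : ∀ u w, (u, w) ∈ A.graph ↔ B (w + u) = u) :
    ∃ Q : G →L[𝕜] G, Q.IsPositive ∧ Q * Q = B - B * B ∧
      ∀ v w, (v, w) ∈ S.graph → Q v = B w := by
  have hP := hS.isPositiveSelfAdjoint
  have hBg : ∀ z, (B z, z - B z) ∈ A.graph := fun z => by rw [hB, sub_add_cancel]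
  choose q hq1 hq2 using fun z => (hS.sq_eq _ _).1 (hBg z)
  have hq : ∀ z y, (B z, y) ∈ S.graph → q z = y := fun z y h =>
    S.mem_graph_snd_inj (hq1 z) h rfl
  let T : G →ₗ[𝕜] G :=
    { toFun := q
      map_add' := fun x y => hq _ _ (by
        rw [map_add]; exact S.graph.add_mem (hq1 x) (hq1 y))
      map_smul' := fun c x => hq _ _ (by
        rw [map_smul]; exact S.graph.smul_mem c (hq1 x)) }
  have hT : T.IsSymmetric := fun x y => by
    change inner 𝕜 (q x) y = inner 𝕜 x (q y)
    calc inner 𝕜 (q x) y = inner 𝕜 (q x) (B y) + inner 𝕜 (q x) (y - B y) := by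
          rw [← inner_add_right, add_sub_cancel]
      _ = inner 𝕜 (B x) (q y) + inner 𝕜 (x - B x) (q y) := by
          rw [hP.inner_eq (hq1 x) (hq1 y), hP.inner_eq (hq2 x) (hq2 y)]
      _ = inner 𝕜 x (q y) := by rw [← inner_add_left, add_sub_cancel]
  have hcomm : ∀ v w, (v, w) ∈ S.graph → q v = B w := fun v w h => by
    -- with `u = B v`, both `v` and `A u = v - u` lie in the domain of `S`, whence `S u ∈ D(A)`
    have h1 : (v - B v, w - q v) ∈ S.graph := S.graph.sub_mem h (hq1 v)
    have h2 : (q v, w - q v) ∈ A.graph := (hS.sq_eq _ _).2 ⟨_, hq2 v, h1⟩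
    rw [hB, sub_add_cancel] at h2
    exact h2.symm
  refine ⟨⟨T, hT.continuous⟩, ⟨hT, fun x => ?_⟩, ?_, hcomm⟩
  · change 0 ≤ RCLike.re (inner 𝕜 (q x) x)
    have e : inner 𝕜 (q x) x = inner 𝕜 (q x) (B x) + inner 𝕜 (q x) (x - B x) := by
      rw [← inner_add_right, add_sub_cancel]
    rw [e, map_add, inner_re_symm (q x) (x - B x)]
    exact add_nonneg (hP.re_inner_nonneg (hq1 x)) (hP.re_inner_nonneg (hq2 x))
  · ext z
    change q (q z) = B z - B (B z)
    -- `q (q z) = S (B (q z)) = S (q (B z)) = S (S (B (B z)))`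
    have h1 : q (B z) = B (q z) := hcomm _ _ (hq1 z)
    refine hq _ _ ?_
    rw [← h1]
    exact hq2 (B z)

end IsPositiveSqrt

end UnboundedOperators

/-! ### Integrability and norm of the kernel -/

section Kernel

theorem kernel_of_le {s t : ℝ} (hs : 0 < s) (hst : s ≤ t) :
    kernel s t = -(1 / √Real.pi * s ^ (-(1 / 2) : ℝ)) := by
  rw [kernel, if_neg hst.not_gt, if_pos hs, Real.rpow_neg hs.le, ← Real.sqrt_eq_rpow, one_div (√s)]
  ring

theorem kernel_of_lt {s t : ℝ} (ht : 0 ≤ t) (hst : t < s) :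
    kernel s t = 1 / √Real.pi * (1 / √(s - t) - 1 / √s) := by
  rw [kernel, if_pos hst, if_pos (ht.trans_lt hst)]

theorem kernel_nonneg_of_lt {s t : ℝ} (ht : 0 ≤ t) (hst : t < s) : 0 ≤ kernel s t := by
  rw [kernel_of_lt ht hst]
  have h1 : 0 < √(s - t) := Real.sqrt_pos.2 (sub_pos.2 hst)
  have h2 : √(s - t) ≤ √s := Real.sqrt_le_sqrt (by linarith)
  have := one_div_le_one_div_of_le h1 h2
  have h3 : 0 ≤ 1 / √Real.pi := by positivity
  exact mul_nonneg h3 (sub_nonneg.2 this)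

theorem tendsto_sqrt_sub_sub_sqrt {t : ℝ} (ht : 0 ≤ t) :
    Tendsto (fun s => √(s - t) - √s) atTop (𝓝 0) := by
  rw [tendsto_zero_iff_norm_tendsto_zero]
  have h0 : Tendsto (fun s => t / √s) atTop (𝓝 0) :=
    tendsto_const_nhds.div_atTop Real.tendsto_sqrt_atTop
  refine squeeze_zero' (Eventually.of_forall fun _ => norm_nonneg _) ?_ h0
  filter_upwards [eventually_gt_atTop t] with s hs
  have hs0 : 0 < s := ht.trans_lt hs
  have h2 : √(s - t) ≤ √s := Real.sqrt_le_sqrt (by linarith)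
  have h3 : 0 < √s := Real.sqrt_pos.2 hs0
  have h4 := Real.mul_self_sqrt hs0.le
  have h5 := Real.mul_self_sqrt (sub_pos.2 hs).le
  have h6 := Real.sqrt_nonneg (s - t)
  rw [Real.norm_eq_abs, abs_of_nonpos (by linarith), le_div_iff₀ h3]
  nlinarith

theorem kernel_Ioi_aux {t : ℝ} (ht : 0 ≤ t) :
    IntegrableOn (fun s => kernel s t) (Ioi t) ∧
      ∫ s in Ioi t, kernel s t = 2 / √Real.pi * √t := by
  let g : ℝ → ℝ := fun s => 2 / √Real.pi * (√(s - t) - √s)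
  have hg : ContinuousWithinAt g (Ici t) t := by
    refine Continuous.continuousWithinAt ?_
    fun_prop
  have hd : ∀ s ∈ Ioi t, HasDerivAt g (kernel s t) s := fun s hs => by
    have hs' : t < s := hs
    have h1 : HasDerivAt (fun s => √(s - t)) (1 / (2 * √(s - t))) s :=
      ((hasDerivAt_id s).sub_const t).sqrt (sub_pos.2 hs').ne'
    have h2 : HasDerivAt (fun s => √s) (1 / (2 * √s)) s :=
      (hasDerivAt_id s).sqrt (ht.trans_lt hs').ne'
    refine ((h1.sub h2).const_mul (2 / √Real.pi)).congr_deriv ?_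
    rw [kernel_of_lt ht hs', ← one_div_mul_one_div, ← one_div_mul_one_div]
    ring
  have hn : ∀ s ∈ Ioi t, 0 ≤ kernel s t := fun s hs => kernel_nonneg_of_lt ht hs
  have hl : Tendsto g atTop (𝓝 0) := by
    simpa using (tendsto_sqrt_sub_sub_sqrt ht).const_mul (2 / √Real.pi)
  refine ⟨integrableOn_Ioi_deriv_of_nonneg hg hd hn hl, ?_⟩
  rw [integral_Ioi_of_hasDerivAt_of_nonneg hg hd hn hl]
  simp [g]

theorem kernel_Ioc_aux {t : ℝ} (ht : 0 ≤ t) :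
    IntegrableOn (fun s => kernel s t) (Ioc 0 t) ∧
      ∫ s in Ioc 0 t, kernel s t = -(2 / √Real.pi * √t) := by
  have e : ∀ s ∈ Ioc 0 t, -(1 / √Real.pi * s ^ (-(1 / 2) : ℝ)) = kernel s t := fun s hs =>
    (kernel_of_le hs.1 hs.2).symm
  constructor
  · have h := (intervalIntegral.intervalIntegrable_rpow' (a := 0) (b := t)
      (r := -(1 / 2)) (by norm_num)).const_mul (1 / √Real.pi)
    exact ((intervalIntegrable_iff_integrableOn_Ioc_of_le ht).1 h).neg.congr_fun e measurableSet_Ioc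
  · rw [← setIntegral_congr_fun measurableSet_Ioc e, ← intervalIntegral.integral_of_le ht,
      intervalIntegral.integral_neg, intervalIntegral.integral_const_mul,
      integral_rpow (Or.inl (by norm_num)), show (-(1 / 2) + 1 : ℝ) = 1 / 2 by norm_num,
      Real.zero_rpow (by norm_num), ← Real.sqrt_eq_rpow]
    ring

theorem integrableOn_kernel {t : ℝ} (ht : 0 ≤ t) :
    IntegrableOn (fun s => kernel s t) (Ioi 0) := by
  rw [← Ioc_union_Ioi_eq_Ioi ht]
  exact (kernel_Ioc_aux ht).1.union (kernel_Ioi_aux ht).1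

theorem integral_abs_kernel {t : ℝ} (ht : 0 ≤ t) :
    ∫ s in Ioi (0 : ℝ), |kernel s t| = 4 / √Real.pi * √t := by
  have e1 : ∫ s in Ioc 0 t, |kernel s t| = 2 / √Real.pi * √t := by
    rw [← neg_eq_iff_eq_neg.2 (kernel_Ioc_aux ht).2, ← integral_neg]
    refine setIntegral_congr_fun measurableSet_Ioc fun s hs => abs_of_nonpos ?_
    rw [kernel_of_le hs.1 hs.2, neg_nonpos]
    have := hs.1
    positivity
  have e2 : ∫ s in Ioi t, |kernel s t| = 2 / √Real.pi * √t := by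
    rw [← (kernel_Ioi_aux ht).2]
    exact setIntegral_congr_fun measurableSet_Ioi fun s hs =>
      abs_of_nonneg (kernel_nonneg_of_lt ht hs)
  rw [← Ioc_union_Ioi_eq_Ioi ht, setIntegral_union Ioc_disjoint_Ioi_same measurableSet_Ioi
    (kernel_Ioc_aux ht).1.abs (kernel_Ioi_aux ht).1.abs, e1, e2]
  ring

end Kernel

/-! ### Semigroups generated by negative self-adjoint operators -/

section Semigroup

variable {𝕜 G : Type*} [RCLike 𝕜] [NormedAddCommGroup G] [InnerProductSpace 𝕜 G]
  {R : ℝ → G →L[𝕜] G}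

theorem mem_graph_neg_generator_iff {v w : G} :
    (v, w) ∈ (-generator R).graph ↔ HasGeneratorAt R v (-w) := by
  rw [← mem_graph_generator_iff, LinearPMap.mem_graph_iff, LinearPMap.mem_graph_iff]
  constructor
  · rintro ⟨y, hy, e⟩
    refine ⟨y, hy, ?_⟩
    change generator R y = -w
    rw [← neg_eq_iff_eq_neg]
    exact e
  · rintro ⟨y, hy, e⟩
    exact ⟨y, hy, neg_eq_iff_eq_neg.2 e⟩

namespace IsContinuousSemigroup

variable (hR : IsContinuousSemigroup R)
include hR

theorem apply_comm {s t : ℝ} (hs : 0 ≤ s) (ht : 0 ≤ t) (x : G) : R s (R t x) = R t (R s x) := by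
  have h1 := congrArg (fun T : G →L[𝕜] G => T x) (hR.map_add s t hs ht)
  have h2 := congrArg (fun T : G →L[𝕜] G => T x) (hR.map_add t s ht hs)
  rw [add_comm] at h1
  exact h1.symm.trans h2

theorem add_apply {s t : ℝ} (hs : 0 ≤ s) (ht : 0 ≤ t) (x : G) : R (s + t) x = R s (R t x) :=
  congrArg (fun T : G →L[𝕜] G => T x) (hR.map_add s t hs ht)

theorem zero_apply (x : G) : R 0 x = x := by rw [hR.map_zero]; rfl

theorem hasGeneratorAt_apply {v w : G} (h : HasGeneratorAt R v w) {s : ℝ} (hs : 0 ≤ s) :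
    HasGeneratorAt R (R s v) (R s w) := by
  refine (((R s).continuous.tendsto w).comp h).congr' ?_
  filter_upwards [self_mem_nhdsWithin] with t ht
  simp only [Function.comp_apply, map_smul, map_sub]
  rw [hR.apply_comm hs (le_of_lt ht)]

theorem intervalIntegrable (w : G) {a b : ℝ} (ha : 0 ≤ a) (hb : 0 ≤ b) :
    IntervalIntegrable (fun s => R s w) volume a b :=
  ((hR.continuousOn w).mono fun _ hx => (le_min ha hb).trans hx.1).intervalIntegrable

end IsContinuousSemigroup

/-- A strongly continuous semigroup of symmetric contractions. -/
structure IsSymmContractionSemigroup (R : ℝ → G →L[𝕜] G) : Prop extends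
    IsContinuousSemigroup R where
  norm_le : ∀ t : ℝ, 0 ≤ t → ∀ x : G, ‖R t x‖ ≤ ‖x‖
  inner_eq : ∀ t : ℝ, 0 ≤ t → ∀ x y : G, inner 𝕜 (R t x) y = inner 𝕜 x (R t y)

namespace IsSymmContractionSemigroup

variable (hR : IsSymmContractionSemigroup R)
include hR

theorem isPositive {t : ℝ} (ht : 0 ≤ t) : (R t).IsPositive := by
  refine ⟨fun x y => hR.inner_eq t ht x y, fun x => ?_⟩
  change 0 ≤ RCLike.re (inner 𝕜 (R t x) x)
  have h : 0 ≤ t / 2 := by positivity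
  rw [← add_halves t, hR.add_apply h h, hR.inner_eq _ h, inner_self_eq_norm_sq]
  positivity

theorem isPositive_one_sub {t : ℝ} (ht : 0 ≤ t) : (1 - R t).IsPositive := by
  refine ⟨LinearMap.IsSymmetric.sub LinearMap.IsSymmetric.id (hR.isPositive ht).isSymmetric,
    fun x => ?_⟩
  change 0 ≤ RCLike.re (inner 𝕜 (x - R t x) x)
  have h := re_inner_le_norm (𝕜 := 𝕜) (R t x) x
  have := mul_le_mul_of_nonneg_right (hR.norm_le t ht x) (norm_nonneg x)
  rw [inner_sub_left, map_sub, inner_self_eq_norm_sq]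
  nlinarith

end IsSymmContractionSemigroup

variable [NormedSpace ℝ G] [IsScalarTower ℝ 𝕜 G]

namespace IsContinuousSemigroup

variable (hR : IsContinuousSemigroup R)
include hR

theorem hasDerivWithinAt_Ioi {v w : G} (h : HasGeneratorAt R v w) {s : ℝ} (hs : 0 ≤ s) :
    HasDerivWithinAt (fun t => R t v) (R s w) (Ioi s) s := by
  rw [hasDerivWithinAt_iff_tendsto_slope' self_notMem_Ioi]
  have h1 := hR.hasGeneratorAt_apply h hs
  have h2 : Tendsto (fun t => t - s) (𝓝[>] s) (𝓝[>] 0) := by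
    refine tendsto_nhdsWithin_iff.2 ⟨?_, ?_⟩
    · have : Tendsto (fun t => t - s) (𝓝 s) (𝓝 (s - s)) := (continuous_sub_right s).tendsto s
      rw [sub_self] at this
      exact this.mono_left nhdsWithin_le_nhds
    · filter_upwards [self_mem_nhdsWithin] with t ht using sub_pos.2 (mem_Ioi.1 ht)
  refine (h1.comp h2).congr' ?_
  filter_upwards [self_mem_nhdsWithin] with t ht
  have ht' : s < t := ht
  rw [Function.comp_apply, slope_def_module, ← hR.add_apply (sub_pos.2 ht').le hs, sub_add_cancel,
    RCLike.real_smul_eq_coe_smul (K := 𝕜)]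

theorem integral_eq_sub [CompleteSpace G] {v w : G} (h : HasGeneratorAt R v w) {t : ℝ}
    (ht : 0 ≤ t) : ∫ s in (0 : ℝ)..t, R s w = R t v - v := by
  rw [intervalIntegral.integral_eq_sub_of_hasDeriv_right_of_le ht
    ((hR.continuousOn v).mono Icc_subset_Ici_self)
    (fun s hs => hR.hasDerivWithinAt_Ioi h hs.1.le) (hR.intervalIntegrable w le_rfl ht),
    hR.zero_apply]

/-- Orbits starting in the domain of the generator are differentiable from both sides: they are
primitives of continuous functions. -/
theorem hasDerivAt [CompleteSpace G] {v w : G} (h : HasGeneratorAt R v w) {t : ℝ} (ht : 0 < t) :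
    HasDerivAt (fun s => R s v) (R t w) t := by
  have hc : ContinuousAt (fun s => R s w) t := (hR.continuousOn w).continuousAt (Ici_mem_nhds ht)
  have h1 : HasDerivAt (fun u => ∫ s in (0 : ℝ)..u, R s w) (R t w) t := by
    refine intervalIntegral.integral_hasDerivAt_right (hR.intervalIntegrable w le_rfl ht.le) ?_ hc
    exact ((hR.continuousOn w).mono Ioi_subset_Ici_self).stronglyMeasurableAtFilter isOpen_Ioi t ht
  refine (h1.add_const v).congr_of_eventuallyEq ?_
  filter_upwards [Ioi_mem_nhds ht] with u hu
  rw [hR.integral_eq_sub h (le_of_lt hu), sub_add_cancel]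

end IsContinuousSemigroup

variable [CompleteSpace G]

theorem IsPositiveSelfAdjoint.norm_apply_le (hR : IsContinuousSemigroup R)
    (hA : IsPositiveSelfAdjoint (-generator R)) {t : ℝ} (ht : 0 ≤ t) (x : G) :
    ‖R t x‖ ≤ ‖x‖ := by
  refine hA.isSelfAdjoint.dense_domain.induction (P := fun x => ‖R t x‖ ≤ ‖x‖) (fun v hv => ?_)
    (isClosed_le ((R t).continuous.norm) continuous_norm) x
  obtain ⟨w, hw⟩ : ∃ w, HasGeneratorAt R v w := hv
  have hanti : AntitoneOn (fun s => RCLike.re (inner 𝕜 (R s v) (R s v))) (Ici 0) := by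
    refine antitoneOn_of_hasDerivWithinAt_nonpos (convex_Ici 0)
      (f' := fun s => RCLike.re (inner 𝕜 (R s v) (R s w) + inner 𝕜 (R s w) (R s v)))
      (RCLike.continuous_re.comp_continuousOn
        ((hR.continuousOn v).inner (𝕜 := 𝕜) (hR.continuousOn v))) ?_ ?_
    · intro s hs
      rw [interior_Ici] at hs
      have h1 := hR.hasDerivAt hw hs
      exact ((RCLike.reCLM (K := 𝕜)).hasFDerivAt.comp_hasDerivAt s
        (h1.inner 𝕜 h1)).hasDerivWithinAt
    · intro s hs
      rw [interior_Ici] at hs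
      have h1 := hR.hasGeneratorAt_apply hw (le_of_lt hs)
      rw [← neg_neg (R s w)] at h1
      have h2 := hA.re_inner_nonneg (mem_graph_neg_generator_iff.2 h1)
      rw [inner_neg_left, map_neg] at h2
      rw [map_add, inner_re_symm]
      linarith
  have h := hanti self_mem_Ici ht ht
  simp only [inner_self_eq_norm_sq, hR.zero_apply] at h
  exact le_of_sq_le_sq h (norm_nonneg _)

/-- The bounded operators `R t` are symmetric: for `x` and `y` in the domain of the generator,
`⟨R s x, R (t - s) y⟩` does not depend on `s ∈ [0, t]`. -/
theorem IsPositiveSelfAdjoint.inner_apply_eq (hR : IsContinuousSemigroup R)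
    (hA : IsPositiveSelfAdjoint (-generator R)) {t : ℝ} (ht : 0 ≤ t) (x y : G) :
    inner 𝕜 (R t x) y = inner 𝕜 x (R t y) := by
  have hd := hA.isSelfAdjoint.dense_domain
  refine hd.induction (P := fun x => inner 𝕜 (R t x) y = inner 𝕜 x (R t y)) (fun v hv => ?_)
    (isClosed_eq (by fun_prop) (by fun_prop)) x
  refine hd.induction (P := fun y => inner 𝕜 (R t v) y = inner 𝕜 v (R t y)) (fun v' hv' => ?_)
    (isClosed_eq (by fun_prop) (by fun_prop)) y
  obtain ⟨w, hw⟩ : ∃ w, HasGeneratorAt R v w := hv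
  obtain ⟨w', hw'⟩ : ∃ w, HasGeneratorAt R v' w := hv'
  have h := intervalIntegral.integral_eq_sub_of_hasDeriv_right_of_le ht
    (f := fun s => inner 𝕜 (R s v) (R (t - s) v')) (f' := fun _ => 0) ?_ ?_ ?_
  · simp only [intervalIntegral.integral_zero, sub_self, sub_zero, hR.zero_apply] at h
    exact sub_eq_zero.1 h.symm
  · refine ContinuousOn.inner ((hR.continuousOn v).mono Icc_subset_Ici_self) ?_
    exact (hR.continuousOn v').comp (by fun_prop) fun s hs => sub_nonneg.2 hs.2
  · intro s hs
    have h1 := hR.hasDerivAt hw hs.1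
    have h2 := (hR.hasDerivAt hw' (sub_pos.2 hs.2)).scomp s ((hasDerivAt_id s).const_sub t)
    refine ((h1.inner 𝕜 h2).congr_deriv ?_).hasDerivWithinAt
    have g1 := hR.hasGeneratorAt_apply hw hs.1.le
    have g2 := hR.hasGeneratorAt_apply hw' (sub_pos.2 hs.2).le
    rw [← neg_neg (R s w)] at g1
    rw [← neg_neg (R (t - s) w')] at g2
    have g3 := hA.inner_eq (mem_graph_neg_generator_iff.2 g1) (mem_graph_neg_generator_iff.2 g2)
    rw [neg_smul, one_smul, ← g3, inner_neg_left]
    exact neg_add_cancel _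
  · exact intervalIntegrable_const

theorem IsPositiveSelfAdjoint.isSymmContractionSemigroup (hR : IsContinuousSemigroup R)
    (hA : IsPositiveSelfAdjoint (-generator R)) : IsSymmContractionSemigroup R where
  toIsContinuousSemigroup := hR
  norm_le _ ht x := hA.norm_apply_le hR ht x
  inner_eq _ ht x y := hA.inner_apply_eq hR ht x y

namespace IsSymmContractionSemigroup

variable (hR : IsSymmContractionSemigroup R)
include hR

theorem norm_apply_sub_le {v w : G} (h : HasGeneratorAt R v w) {t : ℝ} (ht : 0 ≤ t) :
    ‖R t v - v‖ ≤ t * ‖w‖ := by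
  rw [← hR.integral_eq_sub h ht]
  refine (intervalIntegral.norm_integral_le_of_norm_le_const (C := ‖w‖) fun s hs => ?_).trans ?_
  · rw [uIoc_of_le ht] at hs
    exact hR.norm_le s hs.1.le w
  · rw [sub_zero, abs_of_nonneg ht, mul_comm]

end IsSymmContractionSemigroup

end Semigroup

/-! ### Averages of the semigroup -/

section Averages

variable {𝕜 G : Type*} [RCLike 𝕜] [NormedAddCommGroup G] [InnerProductSpace 𝕜 G]
  [NormedSpace ℝ G] [IsScalarTower ℝ 𝕜 G] {R : ℝ → G →L[𝕜] G}

theorem map_real_smul_of_isScalarTower (T : G →L[𝕜] G) (r : ℝ) (x : G) :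
    T (r • x) = r • T x := by
  rw [RCLike.real_smul_eq_coe_smul (K := 𝕜), map_smul, ← RCLike.real_smul_eq_coe_smul (K := 𝕜)]

namespace IsSymmContractionSemigroup

variable (hR : IsSymmContractionSemigroup R)
include hR

omit [IsScalarTower ℝ 𝕜 G] in
theorem integrableOn_smul {f : ℝ → ℝ} (hf : IntegrableOn f (Ioi 0)) (x : G) :
    IntegrableOn (fun s => f s • R s x) (Ioi 0) := by
  refine (hf.norm.mul_const ‖x‖).mono' (hf.1.smul ?_) ?_
  · exact ((hR.continuousOn x).mono Ioi_subset_Ici_self).aestronglyMeasurable measurableSet_Ioi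
  · filter_upwards [ae_restrict_mem measurableSet_Ioi] with s hs
    rw [norm_smul]
    gcongr
    exact hR.norm_le s (le_of_lt hs) x

/-- The bounded operator `∫ f(s) R s ds` on `(0, ∞)`, as a strong integral, for an integrable real
weight `f`. -/
noncomputable def average {f : ℝ → ℝ} (hf : IntegrableOn f (Ioi 0)) : G →L[𝕜] G :=
  LinearMap.mkContinuous
    { toFun := fun x => ∫ s in Ioi (0 : ℝ), f s • R s x
      map_add' := fun x y => by
        simp only [map_add, smul_add]
        exact integral_add (hR.integrableOn_smul hf x) (hR.integrableOn_smul hf y)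
      map_smul' := fun c x => by
        simp only [map_smul, RingHom.id_apply, smul_comm _ c]
        exact integral_smul c _ }
    (∫ s in Ioi (0 : ℝ), ‖f s‖) fun x => by
      refine (norm_integral_le_integral_norm _).trans ?_
      rw [← integral_mul_const]
      refine setIntegral_mono_on (hR.integrableOn_smul hf x).norm (hf.norm.mul_const _)
        measurableSet_Ioi fun s hs => ?_
      rw [norm_smul]
      gcongr
      exact hR.norm_le s (le_of_lt hs) x

theorem average_apply {f : ℝ → ℝ} (hf : IntegrableOn f (Ioi 0)) (x : G) :
    hR.average hf x = ∫ s in Ioi (0 : ℝ), f s • R s x := rfl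

variable [CompleteSpace G]

theorem commute_average {f : ℝ → ℝ} (hf : IntegrableOn f (Ioi 0)) {Z : G →L[𝕜] G}
    (hZ : ∀ s, 0 ≤ s → Commute Z (R s)) : Commute Z (hR.average hf) := by
  ext x
  change Z (∫ s in Ioi (0 : ℝ), f s • R s x) = ∫ s in Ioi (0 : ℝ), f s • R s (Z x)
  rw [← Z.integral_comp_comm (hR.integrableOn_smul hf x)]
  refine setIntegral_congr_fun measurableSet_Ioi fun s hs => ?_
  have := congrArg (fun T : G →L[𝕜] G => T x) (hZ s (le_of_lt hs)).eq
  simp only [map_real_smul_of_isScalarTower]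
  exact congrArg _ this

theorem isPositive_average {f : ℝ → ℝ} (hf : IntegrableOn f (Ioi 0))
    (h0 : ∀ s, 0 < s → 0 ≤ f s) : (hR.average hf).IsPositive := by
  have e1 : ∀ x y, inner 𝕜 x (hR.average hf y) =
      ∫ s in Ioi (0 : ℝ), (f s : 𝕜) * inner 𝕜 x (R s y) := fun x y => by
    rw [average_apply, ← integral_inner (hR.integrableOn_smul hf y)]
    simp only [RCLike.real_smul_eq_coe_smul (K := 𝕜), inner_smul_right]
  have hs : ∀ x y, inner 𝕜 (hR.average hf x) y = inner 𝕜 x (hR.average hf y) := fun x y => by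
    rw [← inner_conj_symm, e1, e1, ← integral_conj]
    refine setIntegral_congr_fun measurableSet_Ioi fun s hs => ?_
    simp only [map_mul, RCLike.conj_ofReal, inner_conj_symm]
    rw [hR.inner_eq s (le_of_lt hs)]
  refine ⟨hs, fun x => ?_⟩
  change 0 ≤ RCLike.re (inner 𝕜 (hR.average hf x) x)
  have hint : IntegrableOn (fun s => (f s : 𝕜) * inner 𝕜 x (R s x)) (Ioi 0) := by
    have := (hR.integrableOn_smul hf x).const_inner (𝕜 := 𝕜) x
    simp only [RCLike.real_smul_eq_coe_smul (K := 𝕜), inner_smul_right] at this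
    exact this
  rw [hs, e1, ← integral_re hint]
  refine setIntegral_nonneg measurableSet_Ioi fun s hs => ?_
  rw [RCLike.re_ofReal_mul]
  exact mul_nonneg (h0 s hs) ((hR.isPositive (le_of_lt hs)).re_inner_nonneg_right x)

end IsSymmContractionSemigroup

/-! ### Resolvents and their square roots as averages -/

theorem integrableOn_exp_neg_mul {r : ℝ} (hr : 0 < r) :
    IntegrableOn (fun s : ℝ => Real.exp (-r * s)) (Ioi 0) := exp_neg_integrableOn_Ioi 0 hr

/-- The weight `s ↦ π^{-1/2} s^{-1/2} e^{-r s}`; its Laplace transform is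
`x ↦ (x + r)^{-1/2}`. -/
noncomputable def rsqrtWeight (r s : ℝ) : ℝ :=
  1 / √Real.pi * (s ^ (-(1 / 2) : ℝ) * Real.exp (-r * s))

theorem rsqrtWeight_nonneg (r : ℝ) {s : ℝ} (hs : 0 < s) : 0 ≤ rsqrtWeight r s := by
  unfold rsqrtWeight
  positivity

theorem integrableOn_rsqrtWeight {r : ℝ} (hr : 0 < r) :
    IntegrableOn (rsqrtWeight r) (Ioi 0) := by
  have := integrableOn_rpow_mul_exp_neg_mul_rpow (p := 1) (s := -(1 / 2)) (b := r)
    (by norm_num) one_pos hr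
  simp only [Real.rpow_one] at this
  exact Integrable.const_mul this _

/-- Polar coordinates for a rotation invariant function on the plane. -/
theorem integral_sq_add_sq {E : Type*} [NormedAddCommGroup E] [NormedSpace ℝ E] (Φ : ℝ → E) :
    ∫ p : ℝ × ℝ, Φ (p.1 ^ 2 + p.2 ^ 2) = Real.pi • ∫ u in Ioi (0 : ℝ), Φ u := by
  rw [← integral_comp_polarCoord_symm, polarCoord_target,
    ← integral_comp_rpow_Ioi Φ (p := 2) two_ne_zero]
  have e : ∀ p : ℝ × ℝ, p.1 • Φ ((polarCoord.symm p).1 ^ 2 + (polarCoord.symm p).2 ^ 2) =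
      (fun r : ℝ => r • Φ (r ^ 2)) p.1 := fun p => by
    simp only [polarCoord_symm_apply]
    congr 2
    linear_combination p.1 ^ 2 * Real.cos_sq_add_sin_sq p.2
  simp only [e]
  rw [Measure.volume_eq_prod, ← Measure.prod_restrict,
    integral_fun_fst (fun r : ℝ => r • Φ (r ^ 2))]
  have e2 : (volume.restrict (Ioo (-Real.pi) Real.pi)).real univ = Real.pi * 2 := by
    rw [measureReal_restrict_apply_univ, Real.volume_real_Ioo_of_le (by linarith [Real.pi_pos])]
    ring
  rw [e2, mul_smul, ← integral_smul]
  congr 1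
  refine setIntegral_congr_fun measurableSet_Ioi fun s _ => ?_
  simp only [smul_smul, abs_two]
  norm_num

theorem integral_comp_sq {E : Type*} [NormedAddCommGroup E] [NormedSpace ℝ E] {Φ : ℝ → E}
    (h : Integrable fun a : ℝ => Φ (a ^ 2)) :
    ∫ a : ℝ, Φ (a ^ 2) = ∫ s in Ioi (0 : ℝ), s ^ (-(1 / 2) : ℝ) • Φ s := by
  rw [← intervalIntegral.integral_Iic_add_Ioi (b := 0) h.integrableOn h.integrableOn,
    ← integral_comp_rpow_Ioi (fun s => s ^ (-(1 / 2) : ℝ) • Φ s) (p := 2) two_ne_zero]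
  have e : ∫ a in Iic (0 : ℝ), Φ (a ^ 2) = ∫ a in Ioi (0 : ℝ), Φ (a ^ 2) := by
    have := integral_comp_neg_Iic 0 fun a : ℝ => Φ (a ^ 2)
    simpa only [neg_sq, neg_zero] using this
  rw [e, ← two_smul ℝ, ← integral_smul]
  refine setIntegral_congr_fun measurableSet_Ioi fun s hs => ?_
  have hs' : 0 < s := hs
  have e3 : |(2 : ℝ)| * s ^ ((2 : ℝ) - 1) * (s ^ (2 : ℝ)) ^ (-(1 / 2) : ℝ) = 2 := by
    rw [← Real.rpow_mul hs'.le, abs_two, mul_assoc, ← Real.rpow_add hs']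
    norm_num
  simp only [smul_smul]
  rw [e3]
  norm_num

namespace IsSymmContractionSemigroup

variable [CompleteSpace G] (hR : IsSymmContractionSemigroup R)
include hR

omit [IsScalarTower ℝ 𝕜 G] [CompleteSpace G] in
theorem integrable_exp_smul_sq {r : ℝ} (hr : 0 < r) (x : G) :
    Integrable fun a : ℝ => Real.exp (-r * a ^ 2) • R (a ^ 2) x := by
  refine ((integrable_exp_neg_mul_sq hr).mul_const ‖x‖).mono' ?_ (Eventually.of_forall fun a => ?_)
  · have : Continuous fun a : ℝ => R (a ^ 2) x :=
      (hR.continuousOn x).comp_continuous (by fun_prop) fun p => mem_Ici.2 (by positivity)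
    exact Continuous.aestronglyMeasurable (Continuous.smul (by fun_prop) this)
  · rw [norm_smul, Real.norm_of_nonneg (Real.exp_pos _).le]
    gcongr
    exact hR.norm_le _ (sq_nonneg _) x

omit [CompleteSpace G] in
theorem average_rsqrtWeight_apply {r : ℝ} (hr : 0 < r) (x : G) :
    hR.average (integrableOn_rsqrtWeight hr) x =
      (1 / √Real.pi) • ∫ a : ℝ, Real.exp (-r * a ^ 2) • R (a ^ 2) x := by
  rw [integral_comp_sq (Φ := fun s => Real.exp (-r * s) • R s x) (hR.integrable_exp_smul_sq hr x),
    average_apply, ← integral_smul]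
  simp only [rsqrtWeight, smul_smul]

/-- The square of `π^{-1/2} ∫ s^{-1/2} e^{-rs} R s ds` is `∫ e^{-rs} R s ds`: after the substitution
`s = a²` this is the evaluation of a rotation invariant integral in polar coordinates. -/
theorem average_rsqrtWeight_mul_self {r : ℝ} (hr : 0 < r) :
    hR.average (integrableOn_rsqrtWeight hr) * hR.average (integrableOn_rsqrtWeight hr) =
      hR.average (integrableOn_exp_neg_mul hr) := by
  ext x
  set Φ : ℝ → G := fun u => Real.exp (-r * u) • R u x with hΦ
  have hint : Integrable (fun p : ℝ × ℝ => Φ (p.1 ^ 2 + p.2 ^ 2)) (volume.prod volume) := by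
    refine (((integrable_exp_neg_mul_sq hr).mul_prod (integrable_exp_neg_mul_sq hr)).mul_const
      ‖x‖).mono' ?_ (Eventually.of_forall fun p => ?_)
    · have : Continuous fun p : ℝ × ℝ => R (p.1 ^ 2 + p.2 ^ 2) x :=
        (hR.continuousOn x).comp_continuous (by fun_prop) fun p => mem_Ici.2 (by positivity)
      exact Continuous.aestronglyMeasurable (Continuous.smul (by fun_prop) this)
    · rw [norm_smul, Real.norm_of_nonneg (Real.exp_pos _).le, ← Real.exp_add, ← mul_add]
      gcongr
      exact hR.norm_le _ (add_nonneg (sq_nonneg _) (sq_nonneg _)) x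
  have hπ : 1 / √Real.pi * (1 / √Real.pi) = 1 / Real.pi := by
    rw [one_div_mul_one_div, Real.mul_self_sqrt Real.pi_pos.le]
  have e : ∀ a : ℝ, Real.exp (-r * a ^ 2) • R (a ^ 2) (hR.average (integrableOn_rsqrtWeight hr) x) =
      (1 / √Real.pi) • ∫ b : ℝ, Φ (a ^ 2 + b ^ 2) := fun a => by
    rw [hR.average_rsqrtWeight_apply hr, map_real_smul_of_isScalarTower,
      ← (R (a ^ 2)).integral_comp_comm (hR.integrable_exp_smul_sq hr x), smul_comm, ← integral_smul]
    congr 2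
    ext b
    rw [map_real_smul_of_isScalarTower, ← hR.add_apply (sq_nonneg a) (sq_nonneg b), smul_smul,
      ← Real.exp_add, ← mul_add]
  change hR.average (integrableOn_rsqrtWeight hr) (hR.average (integrableOn_rsqrtWeight hr) x) = _
  rw [hR.average_rsqrtWeight_apply hr]
  simp only [e]
  rw [integral_smul, smul_smul, hπ, ← integral_prod (fun p : ℝ × ℝ => Φ (p.1 ^ 2 + p.2 ^ 2)) hint,
    ← Measure.volume_eq_prod, integral_sq_add_sq, smul_smul, one_div_mul_cancel Real.pi_ne_zero,
    one_smul, average_apply]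

/-- The Laplace transform of the semigroup inverts `r - L`, where `L` is the generator. -/
theorem average_exp_apply {v w : G} (h : HasGeneratorAt R v w) {r : ℝ} (hr : 0 < r) :
    hR.average (integrableOn_exp_neg_mul hr) (r • v - w) = v := by
  have hd : ∀ s ∈ Ioi (0 : ℝ), HasDerivAt (fun s => -(Real.exp (-r * s) • R s v))
      (Real.exp (-r * s) • R s (r • v - w)) s := fun s hs => by
    have h1 : HasDerivAt (fun s => Real.exp (-r * s)) (Real.exp (-r * s) * -r) s := by
      simpa using ((hasDerivAt_id s).const_mul (-r)).exp
    refine (h1.smul (hR.hasDerivAt h hs)).neg.congr_deriv ?_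
    rw [map_sub, map_real_smul_of_isScalarTower, smul_sub, smul_smul, mul_neg, neg_smul]
    abel
  have hc : ContinuousWithinAt (fun s => -(Real.exp (-r * s) • R s v)) (Ici 0) 0 := by
    refine ContinuousWithinAt.neg (ContinuousWithinAt.smul ?_ (hR.continuousOn v 0 self_mem_Ici))
    exact Continuous.continuousWithinAt (by fun_prop)
  have hl : Tendsto (fun s => -(Real.exp (-r * s) • R s v)) atTop (𝓝 0) := by
    rw [tendsto_zero_iff_norm_tendsto_zero]
    have h0 : Tendsto (fun s : ℝ => Real.exp (-r * s) * ‖v‖) atTop (𝓝 0) := by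
      have : Tendsto (fun s : ℝ => Real.exp (-r * s)) atTop (𝓝 0) :=
        Real.tendsto_exp_atBot.comp (tendsto_id.const_mul_atTop_of_neg (neg_lt_zero.2 hr))
      simpa using this.mul_const ‖v‖
    refine squeeze_zero' (Eventually.of_forall fun _ => norm_nonneg _) ?_ h0
    filter_upwards [eventually_ge_atTop 0] with s hs
    rw [norm_neg, norm_smul, Real.norm_of_nonneg (Real.exp_pos _).le]
    gcongr
    exact hR.norm_le s hs v
  have := integral_Ioi_of_hasDerivAt_of_tendsto hc hd
    (hR.integrableOn_smul (integrableOn_exp_neg_mul hr) _) hl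
  rw [average_apply, this, hR.zero_apply]
  simp

end IsSymmContractionSemigroup

end Averages

/-! ### The representation formula -/

section Representation

variable {𝕜 G : Type*} [RCLike 𝕜] [NormedAddCommGroup G] [InnerProductSpace 𝕜 G]
  [NormedSpace ℝ G] [IsScalarTower ℝ 𝕜 G] [CompleteSpace G] {R : ℝ → G →L[𝕜] G}

namespace IsSymmContractionSemigroup

variable (hR : IsSymmContractionSemigroup R)
include hR

omit [NormedSpace ℝ G] [IsScalarTower ℝ 𝕜 G] [CompleteSpace G] in
theorem commute_apply {s t : ℝ} (hs : 0 ≤ s) (ht : 0 ≤ t) : Commute (R s) (R t) := by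
  ext x
  exact hR.apply_comm hs ht x

omit [NormedSpace ℝ G] [IsScalarTower ℝ 𝕜 G] [CompleteSpace G] in
theorem commute_resolvent {B : G →L[𝕜] G} {r : ℝ}
    (hB : ∀ u w, (u, w) ∈ (-generator R).graph ↔ B (w + (r : 𝕜) • u) = u) {s : ℝ} (hs : 0 ≤ s) :
    Commute (R s) B := by
  ext z
  change R s (B z) = B (R s z)
  have h1 : (B z, z - (r : 𝕜) • B z) ∈ (-generator R).graph := by rw [hB, sub_add_cancel]
  rw [mem_graph_neg_generator_iff] at h1
  have h2 := hR.hasGeneratorAt_apply h1 hs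
  rw [map_neg, ← mem_graph_neg_generator_iff, hB, map_sub, map_smul, sub_add_cancel] at h2
  exact h2.symm

theorem average_exp_eq_resolvent {B : G →L[𝕜] G} {r : ℝ} (hr : 0 < r)
    (hB : ∀ u w, (u, w) ∈ (-generator R).graph ↔ B (w + (r : 𝕜) • u) = u) :
    hR.average (integrableOn_exp_neg_mul hr) = B := by
  ext z
  have h1 : (B z, z - (r : 𝕜) • B z) ∈ (-generator R).graph := by rw [hB, sub_add_cancel]
  rw [mem_graph_neg_generator_iff] at h1
  have := hR.average_exp_apply h1 hr
  rwa [RCLike.real_smul_eq_coe_smul (K := 𝕜), sub_neg_eq_add, add_sub_cancel] at this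

/-- The damped kernel integral is the difference of a shifted and an unshifted copy of the integral
of `rsqrtWeight`. -/
theorem integral_exp_mul_kernel {r : ℝ} (hr : 0 < r) {t : ℝ} (ht : 0 ≤ t) (x : G) :
    ∫ s in Ioi (0 : ℝ), (Real.exp (-r * s) * kernel s t) • R s x =
      Real.exp (-r * t) • R t (hR.average (integrableOn_rsqrtWeight hr) x) -
        hR.average (integrableOn_rsqrtWeight hr) x := by
  set h : ℝ → G := fun s => (Real.exp (-r * t) * rsqrtWeight r (s - t)) • R s x with hh
  have hint := hR.integrableOn_smul (integrableOn_rsqrtWeight hr) x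
  have hpre : (fun s => s + t) ⁻¹' (Ioi t) = Ioi 0 := by
    ext s; simp
  have hcomp : ∀ s ∈ Ioi (0 : ℝ), h (s + t) = Real.exp (-r * t) • R t (rsqrtWeight r s • R s x) :=
    fun s hs => by
      rw [hh, map_real_smul_of_isScalarTower, ← hR.add_apply ht (le_of_lt hs), smul_smul,
        add_comm t s]
      simp only [add_sub_cancel_right]
  have hmp := measurePreserving_add_right (volume : Measure ℝ) t
  have hme := measurableEmbedding_addRight (G := ℝ) t
  have hshift : ∫ s in Ioi t, h s =
      Real.exp (-r * t) • R t (hR.average (integrableOn_rsqrtWeight hr) x) := by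
    rw [← hmp.setIntegral_preimage_emb hme h (Ioi t), hpre,
      setIntegral_congr_fun measurableSet_Ioi hcomp, integral_smul, average_apply,
      (R t).integral_comp_comm hint]
  have hshift_int : IntegrableOn h (Ioi t) := by
    rw [← hmp.integrableOn_comp_preimage hme, hpre]
    have h2 : IntegrableOn (fun s => Real.exp (-r * t) • R t (rsqrtWeight r s • R s x)) (Ioi 0) :=
      ((R t).integrable_comp hint).smul _
    exact h2.congr_fun (fun s hs => (hcomp s hs).symm) measurableSet_Ioi
  have hind : IntegrableOn ((Ioi t).indicator h) (Ioi 0) :=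
    ((integrable_indicator_iff measurableSet_Ioi).2 hshift_int).integrableOn
  have e : ∀ s ∈ Ioi (0 : ℝ), (Real.exp (-r * s) * kernel s t) • R s x =
      (Ioi t).indicator h s - rsqrtWeight r s • R s x := fun s hs => by
    have hs' : 0 < s := hs
    by_cases hst : t < s
    · have h1 : Real.exp (-r * s) = Real.exp (-r * t) * Real.exp (-r * (s - t)) := by
        rw [← Real.exp_add]; congr 1; ring
      rw [indicator_of_mem (mem_Ioi.2 hst), hh, ← sub_smul]
      congr 1
      rw [kernel_of_lt ht hst, rsqrtWeight, rsqrtWeight, Real.rpow_neg hs'.le,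
        Real.rpow_neg (sub_pos.2 hst).le, ← Real.sqrt_eq_rpow, ← Real.sqrt_eq_rpow, one_div (√s),
        one_div √(s - t)]
      linear_combination (1 / √Real.pi * (√(s - t))⁻¹) * h1
    · rw [indicator_of_notMem (mt mem_Ioi.1 hst), kernel_of_le hs' (not_lt.1 hst), zero_sub,
        ← neg_smul, rsqrtWeight]
      congr 1
      ring
  rw [setIntegral_congr_fun measurableSet_Ioi e, integral_sub hind hint,
    setIntegral_indicator measurableSet_Ioi, inter_eq_self_of_subset_right (Ioi_subset_Ioi ht),
    hshift, average_apply]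

omit [IsScalarTower ℝ 𝕜 G] [CompleteSpace G] in
theorem tendsto_integral_exp_mul_kernel {t : ℝ} (ht : 0 ≤ t) (x : G) :
    Tendsto (fun r : ℝ => ∫ s in Ioi (0 : ℝ), (Real.exp (-r * s) * kernel s t) • R s x) (𝓝[>] 0)
      (𝓝 (∫ s in Ioi (0 : ℝ), kernel s t • R s x)) := by
  have hint := hR.integrableOn_smul (integrableOn_kernel ht) x
  refine tendsto_integral_filter_of_dominated_convergence (fun s => ‖kernel s t • R s x‖)
    (Eventually.of_forall fun r => ?_) ?_ hint.norm (Eventually.of_forall fun s => ?_)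
  · simp only [mul_smul]
    have hc : Continuous fun s => Real.exp (-r * s) := by fun_prop
    exact hc.aestronglyMeasurable.smul hint.1
  · filter_upwards [self_mem_nhdsWithin] with r hr
    filter_upwards [ae_restrict_mem measurableSet_Ioi] with s hs
    rw [mul_smul, norm_smul, Real.norm_of_nonneg (Real.exp_pos _).le]
    refine mul_le_of_le_one_left (norm_nonneg _) (Real.exp_le_one_iff.2 ?_)
    have := mul_pos (mem_Ioi.1 hr) (mem_Ioi.1 hs)
    linarith
  · have hc : Continuous fun r : ℝ => (Real.exp (-r * s) * kernel s t) • R s x := by fun_prop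
    have := hc.tendsto 0
    simp only [neg_zero, zero_mul, Real.exp_zero, one_mul] at this
    exact this.mono_left nhdsWithin_le_nhds

/-- Quantitative comparison, for `B = (1 + A)⁻¹`, `Q = √A B` and the damped inverse square root `J`
of `r + A`, of `J Q` with `B` after application of `1 - R t`. The squares of `J Q` and `B`
differ by `-r (r + A)⁻¹ B²`; the factor `1 - R t` keeps `(1 - R t) (r + A)⁻¹` bounded as `r → 0`. -/
theorem norm_rsqrt_mul_sub_le (hA : IsPositiveSelfAdjoint (-generator R)) {B Q : G →L[𝕜] G}
    (hBpos : B.IsPositive)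
    (hB : ∀ u w, (u, w) ∈ (-generator R).graph ↔ B (w + u) = u)
    (hQ : Q.IsPositive) (hQQ : Q * Q = B - B * B) {t : ℝ} (ht : 0 ≤ t) (z : G) {r : ℝ}
    (hr : 0 < r) :
    ‖((1 - R t) * (hR.average (integrableOn_rsqrtWeight hr) * Q) - (1 - R t) * B) z‖ ^ 2 ≤
        r * (t * ‖(1 - R t) (B (B z))‖ * ‖z‖) ∧
      ‖(hR.average (integrableOn_rsqrtWeight hr) * Q) z‖ ^ 2 ≤ ‖B (B z)‖ * ‖z‖ := by
  set J := hR.average (integrableOn_rsqrtWeight hr) with hJ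
  set N : G →L[𝕜] G := 1 - R t with hN
  have hJpos : J.IsPositive := hR.isPositive_average _ fun s hs => rsqrtWeight_nonneg r hs
  have hNpos : N.IsPositive := hR.isPositive_one_sub ht
  obtain ⟨E, -, hEA⟩ := hA.exists_resolvent hr
  have hJJ : J * J = E := by
    rw [hJ, hR.average_rsqrtWeight_mul_self hr, hR.average_exp_eq_resolvent hr hEA]
  -- all operators involved commute
  have hRB : ∀ s, 0 ≤ s → Commute (R s) B := fun s hs =>
    hR.commute_resolvent (r := 1) (by simpa using hB) hs
  have hBQ : Commute B Q := commute_of_commute_mul_self hQ (by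
    rw [hQQ]; exact (Commute.refl B).sub_right ((Commute.refl B).mul_right (Commute.refl B)))
  have hRQ : ∀ s, 0 ≤ s → Commute (R s) Q := fun s hs => commute_of_commute_mul_self hQ (by
    rw [hQQ]; exact (hRB s hs).sub_right ((hRB s hs).mul_right (hRB s hs)))
  have hNR : ∀ s, 0 ≤ s → Commute N (R s) := fun s hs =>
    (Commute.one_left _).sub_left (hR.commute_apply ht hs)
  have hBJ : Commute B J := hR.commute_average _ fun s hs => (hRB s hs).symm
  have hQJ : Commute Q J := hR.commute_average _ fun s hs => (hRQ s hs).symm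
  have hNJ : Commute N J := hR.commute_average _ hNR
  have hNB : Commute N B := (Commute.one_left _).sub_left (hRB t ht)
  have hNQ : Commute N Q := (Commute.one_left _).sub_left (hRQ t ht)
  have hNE : Commute N E := hJJ ▸ hNJ.mul_right hNJ
  have hBE : Commute B E := hJJ ▸ hBJ.mul_right hBJ
  have hEg : ∀ u, (E u, u - (r : 𝕜) • E u) ∈ (-generator R).graph := fun u => by
    rw [hEA, sub_add_cancel]
  -- the second resolvent identity in the form `(r + A)⁻¹ A B = B - r (r + A)⁻¹ B`
  have hres : E - E * B = B - (r : 𝕜) • (E * B) := by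
    ext u
    have h1 : (B u, u - B u) ∈ (-generator R).graph := by rw [hB, sub_add_cancel]
    have h2 := (hEA _ _).1 h1
    rw [map_add, map_sub, map_smul] at h2
    exact eq_sub_of_add_eq h2
  have hsq : J * Q * (J * Q) = B * B - (r : 𝕜) • (E * (B * B)) := by
    rw [hQJ.mul_mul_mul_comm, hJJ, hQQ, mul_sub, ← mul_assoc, ← sub_mul, hres, sub_mul,
      smul_mul_assoc, mul_assoc]
  have hJQ : (J * Q).IsPositive := isPositive_mul_of_commute hJpos hQ hQJ.symm
  have hM1 : (N * (J * Q)).IsPositive :=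
    isPositive_mul_of_commute hNpos hJQ (hNJ.mul_right hNQ)
  have hM2 : (N * B).IsPositive := isPositive_mul_of_commute hNpos hBpos hNB
  have hcomm : Commute (N * (J * Q)) (N * B) := by
    refine Commute.mul_left ((Commute.refl N).mul_right hNB) (Commute.mul_left ?_ ?_)
    · exact hNJ.symm.mul_right hBJ.symm
    · exact hNQ.symm.mul_right hBQ.symm
  have hdiff : N * (J * Q) * (N * (J * Q)) - N * B * (N * B) =
      -((r : 𝕜) • (N * E * (N * (B * B)))) := by
    rw [(hNJ.mul_right hNQ).symm.mul_mul_mul_comm, hNB.symm.mul_mul_mul_comm, hsq, mul_sub,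
      sub_sub_cancel_left, mul_smul_comm, hNE.symm.mul_mul_mul_comm]
  constructor
  · refine (norm_sub_apply_sq_le_of_isPositive hM1 hM2 hcomm z).trans ?_
    rw [hdiff]
    have h1 : ∀ u, ‖N (E u)‖ ≤ t * ‖u‖ := fun u => by
      have h2 := hR.norm_apply_sub_le (mem_graph_neg_generator_iff.1 (hEg u)) ht
      have h3 := hA.norm_le_norm_add (hEg u) hr.le
      rw [sub_add_cancel] at h3
      rw [norm_neg] at h2
      change ‖E u - R t (E u)‖ ≤ _
      rw [norm_sub_rev]
      exact h2.trans (by gcongr)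
    have h4 : ‖(-((r : 𝕜) • (N * E * (N * (B * B))))) z‖ = r * ‖N (E (N (B (B z))))‖ := by
      rw [_root_.neg_apply, norm_neg]
      change ‖(r : 𝕜) • N (E (N (B (B z))))‖ = _
      rw [norm_smul, RCLike.norm_ofReal, abs_of_pos hr]
    rw [h4, mul_assoc]
    gcongr
    exact h1 _
  · have h1 : ‖(J * Q) z‖ ^ 2 = RCLike.re (inner 𝕜 ((J * Q * (J * Q)) z) z) := by
      rw [← inner_self_eq_norm_sq (𝕜 := 𝕜), ← hJQ.inner_left_eq_inner_right]
      rfl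
    rw [h1, hsq]
    refine (re_inner_le_norm _ _).trans ?_
    gcongr
    have h3 := hA.norm_le_norm_add (hEg (B (B z))) hr.le
    rwa [sub_add_cancel] at h3

/-- The representation formula for the vectors `B z`, at which `√A` takes the value `Q z`. -/
theorem integral_kernel_smul_eq (hA : IsPositiveSelfAdjoint (-generator R)) {B Q : G →L[𝕜] G}
    (hBpos : B.IsPositive)
    (hB : ∀ u w, (u, w) ∈ (-generator R).graph ↔ B (w + u) = u)
    (hQ : Q.IsPositive) (hQQ : Q * Q = B - B * B) {t : ℝ} (ht : 0 ≤ t) (z : G) :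
    ∫ s in Ioi (0 : ℝ), kernel s t • R s (Q z) = R t (B z) - B z := by
  refine tendsto_nhds_unique (hR.tendsto_integral_exp_mul_kernel ht (Q z)) ?_
  rw [tendsto_iff_norm_sub_tendsto_zero]
  set a := t * ‖(1 - R t) (B (B z))‖ * ‖z‖
  set b := ‖B (B z)‖ * ‖z‖
  have hlim : Tendsto (fun r : ℝ => √(r * a) + (1 - Real.exp (-r * t)) * √b) (𝓝[>] 0) (𝓝 0) := by
    have hc : Continuous fun r : ℝ => √(r * a) + (1 - Real.exp (-r * t)) * √b := by fun_prop
    have := hc.tendsto 0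
    simp only [zero_mul, Real.sqrt_zero, neg_zero, Real.exp_zero, sub_self, add_zero] at this
    exact this.mono_left nhdsWithin_le_nhds
  refine squeeze_zero' (Eventually.of_forall fun _ => norm_nonneg _) ?_ hlim
  filter_upwards [self_mem_nhdsWithin] with r hr
  obtain ⟨h1, h2⟩ := hR.norm_rsqrt_mul_sub_le hA hBpos hB hQ hQQ ht z hr
  rw [hR.integral_exp_mul_kernel hr ht]
  set J := hR.average (integrableOn_rsqrtWeight hr)
  have h3 := Real.le_sqrt_of_sq_le h1
  have h4 := Real.le_sqrt_of_sq_le h2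
  have e : Real.exp (-r * t) • R t (J (Q z)) - J (Q z) - (R t (B z) - B z) =
      -(((1 - R t) * (J * Q) - (1 - R t) * B) z) -
        (1 - Real.exp (-r * t)) • R t ((J * Q) z) := by
    change _ = -((J (Q z) - R t (J (Q z))) - (B z - R t (B z))) -
      (1 - Real.exp (-r * t)) • R t (J (Q z))
    rw [sub_smul, one_smul]
    abel
  have h5 : 0 ≤ 1 - Real.exp (-r * t) := by
    rw [sub_nonneg, Real.exp_le_one_iff]
    have := mul_nonneg (le_of_lt (mem_Ioi.1 hr)) ht
    linarith
  rw [e]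
  refine (norm_sub_le _ _).trans ?_
  rw [norm_neg, norm_smul, Real.norm_of_nonneg h5]
  gcongr
  exact (hR.norm_le t ht _).trans h4

/-- The representation formula. Both sides are transported to the range of `B = (1 + A)⁻¹`, where
the formula is known; `B` is injective and commutes with everything in sight. -/
theorem apply_sub_eq_integral_kernel (hA : IsPositiveSelfAdjoint (-generator R))
    {S : G →ₗ.[𝕜] G} (hS : IsPositiveSqrt (-generator R) S) {v w : G} (hv : (v, w) ∈ S.graph)
    {t : ℝ} (ht : 0 ≤ t) :
    R t v - v = ∫ s in Ioi (0 : ℝ), kernel s t • R s w := by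
  obtain ⟨B, hBpos, hB⟩ := hA.exists_resolvent one_pos
  have hRB : ∀ s, 0 ≤ s → Commute (R s) B := fun s hs => hR.commute_resolvent hB hs
  simp only [RCLike.ofReal_one, one_smul] at hB
  obtain ⟨Q, hQ, hQQ, hQS⟩ := hS.exists_mul_resolvent hB
  have hinj : ∀ x, B x = 0 → x = 0 := fun x h => by
    have h1 : (B x, x - B x) ∈ (-generator R).graph := by rw [hB, sub_add_cancel]
    rw [h, sub_zero] at h1
    exact LinearPMap.graph_fst_eq_zero_snd _ h1 rfl
  have hBR : ∀ s, 0 ≤ s → ∀ x, B (R s x) = R s (B x) := fun s hs x =>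
    (congrArg (fun T : G →L[𝕜] G => T x) (hRB s hs).eq).symm
  have hint := hR.integrableOn_smul (integrableOn_kernel ht) w
  refine sub_eq_zero.1 (hinj _ ?_)
  rw [map_sub, map_sub, hBR t ht, ← B.integral_comp_comm hint, sub_eq_zero,
    ← hR.integral_kernel_smul_eq hA hBpos hB hQ hQQ ht v, hQS v w hv]
  refine setIntegral_congr_fun measurableSet_Ioi fun s hs => ?_
  simp only [map_real_smul_of_isScalarTower]
  rw [hBR s (le_of_lt hs)]

end IsSymmContractionSemigroup

end Representation

end FractionalEstimate

theorem mainTheorem4 :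
    (∀ t : ℝ, 0 ≤ t →
      IntegrableOn (fun s : ℝ => FractionalEstimate.kernel s t) (Ioi 0) ∧
      ∫ s in Ioi (0 : ℝ), |FractionalEstimate.kernel s t| = 4 / √Real.pi * √t) ∧
    ∀ (𝕜 : Type*) (G : Type*) [RCLike 𝕜] [NormedAddCommGroup G] [InnerProductSpace 𝕜 G]
      [NormedSpace ℝ G] [IsScalarTower ℝ 𝕜 G] [CompleteSpace G]
      (R : ℝ → G →L[𝕜] G), FractionalEstimate.IsContinuousSemigroup R →
      FractionalEstimate.IsPositiveSelfAdjoint (-FractionalEstimate.generator R) →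
      (∃ S : G →ₗ.[𝕜] G,
        FractionalEstimate.IsPositiveSqrt (-FractionalEstimate.generator R) S) ∧
      ∀ S : G →ₗ.[𝕜] G,
        FractionalEstimate.IsPositiveSqrt (-FractionalEstimate.generator R) S →
        ∀ (v : S.domain) (t : ℝ), 0 ≤ t →
          IntegrableOn (fun s : ℝ => FractionalEstimate.kernel s t • R s (S v)) (Ioi 0) ∧
          R t (v : G) - (v : G) =
            ∫ s in Ioi (0 : ℝ), FractionalEstimate.kernel s t • R s (S v) := by
  refine ⟨fun t ht => ⟨FractionalEstimate.integrableOn_kernel ht,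
    FractionalEstimate.integral_abs_kernel ht⟩, ?_⟩
  intro 𝕜 G _ _ _ _ _ _ R hR hA
  have hR' := hA.isSymmContractionSemigroup hR
  exact ⟨hA.exists_isPositiveSqrt, fun S hS v t ht =>
    ⟨hR'.integrableOn_smul (FractionalEstimate.integrableOn_kernel ht) _,
      hR'.apply_sub_eq_integral_kernel hA hS (S.mem_graph v) ht⟩⟩
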